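/- Let $\mathcal X_r$ be a real Hilbert space with scalar product $\langle\cdot,\cdot\rangle_r$, let $J_r$ be a bounded operator on $\mathcal X_r$ with $J_r^*=-J_r$ and $J_r^2=-1$, and let $B_r$ be a (possibly unbounded, densely defined) selfadjoint operator on $\mathcal X_r$ that is nonnegative and invertible, i.e. $\langle B_rx,x\rangle_r\ge 0$ for $x\in D(B_r)$ and $B_r:D(B_r)\to\mathcal X_r$ is bijective. Let $\Lambda_r:=B_r^{1/2}$ be its unique nonnegative selfadjoint square root, which is a bijection $D(\Lambda_r)\to\mathcal X_r$, and let $\mathcal V_r:=D(\Lambda_r)$ with the norm $\|X\|_{\mathcal V_r}:=\|\Lambda_rX\|_{\mathcal X_r}$. A function $X_r\in C(\mathbb R,\mathcal V_r)$ is called a solution of $$\dot X_r(t)=J_rB_rX_r(t)\tag{1}$$ if for all $t\in\mathbb R$ we have $\int_0^tX_r(s)\,ds\in D(B_r)$ and $X_r(t)-X_r(0)=J_rB_r\int_0^tX_r(s)\,ds$. The energy is $\mathcal H_0(X):=\tfrac12\langle B_rX,X\rangle_r$, understood as the quadratic form $\tfrac12\|\Lambda_rX\|^2$ for $X\in\mathcal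 V_r$. Let $\mathcal X=\mathcal X_r+i\mathcal X_r$ be the complexification of $\mathcal X_r$, let $B$, $J$ be the complexifications of $B_r$, $J_r$, let $\Lambda:=B^{1/2}$ be the unique nonnegative selfadjoint square root of $B$, and let $H:=\Lambda iJ\Lambda$ with $D(H)=\{Z\in D(\Lambda): J\Lambda Z\in D(\Lambda)\}$. Then: i) For every $X_0\in\mathcal V_r$ there is exactly one solution $X_r\in C(\mathbb R,\mathcal V_r)$ of (1) with $X_r(0)=X_0$, and every solution satisfies $\mathcal H_0(X_r(t))=\mathcal H_0(X_r(0))$ for all $t\in\mathbb R$. ii) $H$ has a spectral resolution, that is, there is a right-continuous nondecreasing family $E(\omega)$, $\omega\in\mathbb R$, of orthogonal projections on $\mathcal X$, tending strongly to $0$ as $\omega\to-\infty$ and to $1$ as $\omega\to\infty$, such that $HZ=\int\omega\,dE(\omega)Z$, with $D(H)$ the set of those $Z$ for which this integral converges. For any such $E$, write $E(\omega)x=E_{rr}(\omega)x+iE_{ir}(\omega)x$ for $x\in\mathcal X_r$, with $E_{rr}(\omega)x,\,E_{ir}(\omega)x\in\mathcal X_r$. Then every solution $X_r\in C(\mathbb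 R,\mathcal V_r)$ of (1) satisfies, for all $t\in\mathbb R$, $$X_r(t)=\Lambda_r^{-1}\int\bigl[\cos\omega t\,dE_{rr}(\omega)+\sin\omega t\,dE_{ir}(\omega)\bigr]\Lambda_rX_r(0),$$ where the integrals of both terms converge in $\mathcal X_r$. Here $\int f\,dF$, for a vector-valued function $F$ on $\mathbb R$, is the Riemann–Stieltjes integral: the norm limit as $a\to-\infty$, $b\to\infty$ of $\int_a^bf\,dF$, each of which is the norm limit of the sums $\sum_k f(\xi_k)\,(F(x_{k+1})-F(x_k))$ over tagged partitions of $[a,b]$ as the mesh tends to $0$. -/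

import Mathlib

open Filter Topology

namespace HamiltonSpectral

noncomputable section

/-! ### Nonnegative operators and their square roots -/

section SquareRoot

variable {𝕜 E : Type*} [RCLike 𝕜] [NormedAddCommGroup E] [InnerProductSpace 𝕜 E]

/-- The (possibly unbounded) operator `T` is nonnegative: `⟨T x, x⟩ ≥ 0` on its domain. -/
def IsNonneg (T : E →ₗ.[𝕜] E) : Prop :=
  ∀ x : T.domain, 0 ≤ RCLike.re (inner 𝕜 (T x) (x : E))

/-- `S` is a nonnegative selfadjoint square root of `T`: the equality `S ∘ S = T` of unbounded
operators (with equality of domains) is expressed through the graphs. -/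
structure IsPosSqrt [CompleteSpace E] (T S : E →ₗ.[𝕜] E) : Prop where
  selfAdjoint : IsSelfAdjoint S
  nonneg : IsNonneg S
  sq : ∀ x y : E, (x, y) ∈ T.graph ↔ ∃ z : E, (x, z) ∈ S.graph ∧ (z, y) ∈ S.graph

/-- The nonnegative selfadjoint square root `T^{1/2}` (an arbitrary operator if there is none). -/
def opSqrt [CompleteSpace E] (T : E →ₗ.[𝕜] E) : E →ₗ.[𝕜] E :=
  Classical.epsilon (IsPosSqrt T)

end SquareRoot

/-! ### Riemann–Stieltjes integrals with a vector-valued integrator -/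

section Stieltjes

variable {𝕜 E : Type*} [NormedField 𝕜] [NormedAddCommGroup E] [NormedSpace 𝕜 E]

/-- `I = ∫_a^b f dF` (for `a ≤ b`): the sums `∑ f (ξ_i) (F (x_{i+1}) - F (x_i))` over tagged
partitions `a = x_0 ≤ ξ_0 ≤ x_1 ≤ ξ_1 ≤ … ≤ x_n = b` converge in norm to `I` as the mesh
goes to zero. -/
def HasStieltjesIntegralOn (f : ℝ → 𝕜) (F : ℝ → E) (a b : ℝ) (I : E) : Prop :=
  ∀ ε > 0, ∃ δ > 0, ∀ (n : ℕ) (x ξ : ℕ → ℝ), x 0 = a → x n = b →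
    (∀ i < n, x i ≤ ξ i ∧ ξ i ≤ x (i + 1) ∧ x (i + 1) - x i < δ) →
    ‖(∑ i ∈ Finset.range n, f (ξ i) • (F (x (i + 1)) - F (x i))) - I‖ < ε

/-- `I = ∫_ℝ f dF`: all the integrals `∫_a^b f dF` exist, and they converge in norm to `I`
as `a → -∞` and `b → ∞`. -/
def HasStieltjesIntegral (f : ℝ → 𝕜) (F : ℝ → E) (I : E) : Prop :=
  ∃ G : ℝ → ℝ → E, (∀ a b : ℝ, a ≤ b → HasStieltjesIntegralOn f F a b (G a b)) ∧
    Tendsto (fun p : ℝ × ℝ => G p.1 p.2) (atBot ×ˢ atTop) (𝓝 I)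

end Stieltjes

/-! ### Spectral resolutions -/

section SpectralResolution

variable {Y : Type*} [NormedAddCommGroup Y] [InnerProductSpace ℂ Y] [CompleteSpace Y]

/-- `E` is the spectral resolution of `H`: a right-continuous monotone family of orthogonal
projections, increasing from `0` to `1`, with `H = ∫ ω dE(ω)`; here `D(H)` is the set of
vectors on which the integral converges. -/
structure IsSpectralResolution (H : Y →ₗ.[ℂ] Y) (E : ℝ → Y →L[ℂ] Y) : Prop where
  projection : ∀ ω, IsStarProjection (E ω)
  mono : ∀ ω ω' : ℝ, ω ≤ ω' → (E ω).comp (E ω') = E ω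
  right_continuous : ∀ (ω : ℝ) (z : Y), Tendsto (fun μ => E μ z) (𝓝[>] ω) (𝓝 (E ω z))
  tendsto_atBot : ∀ z : Y, Tendsto (fun ω => E ω z) atBot (𝓝 0)
  tendsto_atTop : ∀ z : Y, Tendsto (fun ω => E ω z) atTop (𝓝 z)
  integral : ∀ z w : Y,
    (z, w) ∈ H.graph ↔ HasStieltjesIntegral (fun ω : ℝ => (ω : ℂ)) (fun ω => E ω z) w

/-- The subspace `{z ∈ D(Λ) : J Λ z ∈ D(Λ)}`. -/
def schrodingerDomain (Λ : Y →ₗ.[ℂ] Y) (J : Y →ₗ[ℂ] Y) : Submodule ℂ Y :=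
  (Λ.domain.comap (J ∘ₗ Λ.toFun)).map Λ.domain.subtype

theorem mem_schrodingerDomain {Λ : Y →ₗ.[ℂ] Y} {J : Y →ₗ[ℂ] Y} {z : Y} :
    z ∈ schrodingerDomain Λ J ↔ ∃ h : z ∈ Λ.domain, J (Λ ⟨z, h⟩) ∈ Λ.domain := by
  constructor
  · rintro ⟨w, hw, rfl⟩
    exact ⟨w.2, hw⟩
  · rintro ⟨h, h'⟩
    exact ⟨⟨z, h⟩, h', rfl⟩

theorem schrodingerDomain_le (Λ : Y →ₗ.[ℂ] Y) (J : Y →ₗ[ℂ] Y) :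
    schrodingerDomain Λ J ≤ Λ.domain :=
  fun _ hz => (mem_schrodingerDomain.1 hz).1

/-- The operator `H = Λ i J Λ` on `D(H) = {z ∈ D(Λ) : J Λ z ∈ D(Λ)}`. -/
def schrodingerOp (Λ : Y →ₗ.[ℂ] Y) (J : Y →ₗ[ℂ] Y) : Y →ₗ.[ℂ] Y where
  domain := schrodingerDomain Λ J
  toFun := Λ.toFun ∘ₗ LinearMap.codRestrict Λ.domain
    ((Complex.I • J) ∘ₗ Λ.toFun ∘ₗ Submodule.inclusion (schrodingerDomain_le Λ J))
    (fun z => Λ.domain.smul_mem Complex.I (mem_schrodingerDomain.1 z.2).2)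

end SpectralResolution

/-! ### The complexification of a real Hilbert space and of its operators -/

/-- The complexification `X ⊕ iX` of a real Hilbert space `X`, normed by
`‖x + iy‖² = ‖x‖² + ‖y‖²`. -/
def Complexification (X : Type*) : Type _ := WithLp 2 (X × X)

namespace Complexification

variable {X : Type*} [NormedAddCommGroup X] [InnerProductSpace ℝ X]

instance : NormedAddCommGroup (Complexification X) :=
  inferInstanceAs (NormedAddCommGroup (WithLp 2 (X × X)))

instance [CompleteSpace X] : CompleteSpace (Complexification X) :=
  inferInstanceAs (CompleteSpace (WithLp 2 (X × X)))

/-- The vector `x + iy`. -/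
def mk (x y : X) : Complexification X := WithLp.toLp 2 (x, y)

/-- The real part of `x + iy`. -/
def re (z : Complexification X) : X := WithLp.fst z

/-- The imaginary part of `x + iy`. -/
def im (z : Complexification X) : X := WithLp.snd z

@[simp] theorem re_mk (x y : X) : re (mk x y) = x := rfl
@[simp] theorem im_mk (x y : X) : im (mk x y) = y := rfl
@[simp] theorem re_add (z w : Complexification X) : re (z + w) = re z + re w := rfl
@[simp] theorem im_add (z w : Complexification X) : im (z + w) = im z + im w := rfl
@[simp] theorem re_zero : re (0 : Complexification X) = 0 := rfl
@[simp] theorem im_zero : im (0 : Complexification X) = 0 := rfl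

theorem ext {z w : Complexification X} (h₁ : re z = re w) (h₂ : im z = im w) : z = w :=
  WithLp.ofLp_injective 2 (Prod.ext h₁ h₂)

instance : SMul ℂ (Complexification X) where
  smul c z := mk (c.re • re z - c.im • im z) (c.re • im z + c.im • re z)

@[simp] theorem re_smul (c : ℂ) (z : Complexification X) :
    re (c • z) = c.re • re z - c.im • im z := rfl
@[simp] theorem im_smul (c : ℂ) (z : Complexification X) :
    im (c • z) = c.re • im z + c.im • re z := rfl

instance : Module ℂ (Complexification X) where
  one_smul z := by apply ext <;> simp
  mul_smul a b z := by
    apply ext <;> simp only [re_smul, im_smul, Complex.mul_re, Complex.mul_im] <;> module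
  smul_zero a := by apply ext <;> simp
  smul_add a z w := by
    apply ext <;> simp only [re_smul, im_smul, re_add, im_add] <;> module
  add_smul a b z := by
    apply ext <;> simp only [re_smul, im_smul, re_add, im_add, Complex.add_re, Complex.add_im] <;>
      module
  zero_smul z := by apply ext <;> simp

theorem norm_sq (z : Complexification X) : ‖z‖ ^ 2 = ‖re z‖ ^ 2 + ‖im z‖ ^ 2 :=
  WithLp.prod_norm_sq_eq_of_L2 (α := X) (β := X) z

/-- `⟨x + iy, x' + iy'⟩ = ⟨x, x'⟩ + ⟨y, y'⟩ + i (⟨x, y'⟩ - ⟨y, x'⟩)`: the sesquilinear extension,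
conjugate linear in the first argument. -/
instance : Inner ℂ (Complexification X) where
  inner z w :=
    ⟨inner ℝ (re z) (re w) + inner ℝ (im z) (im w), inner ℝ (re z) (im w) - inner ℝ (im z) (re w)⟩

theorem inner_def (z w : Complexification X) : inner ℂ z w =
    ⟨inner ℝ (re z) (re w) + inner ℝ (im z) (im w),
      inner ℝ (re z) (im w) - inner ℝ (im z) (re w)⟩ := rfl

instance : InnerProductSpace ℂ (Complexification X) where
  norm_smul_le c z := by
    apply le_of_eq
    have h : ‖c • z‖ ^ 2 = (‖c‖ * ‖z‖) ^ 2 := by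
      rw [mul_pow, norm_sq, norm_sq, re_smul, im_smul, norm_sub_sq_real, norm_add_sq_real,
        ← Complex.normSq_eq_norm_sq, Complex.normSq_apply]
      simp only [norm_smul, inner_smul_left, inner_smul_right, mul_pow, Real.norm_eq_abs, sq_abs,
        conj_trivial, real_inner_comm (re z) (im z)]
      ring
    exact (sq_eq_sq₀ (norm_nonneg _) (by positivity)).1 h
  norm_sq_eq_re_inner z := by
    rw [norm_sq, inner_def]
    simp
  conj_inner_symm z w := by
    rw [inner_def, inner_def]
    apply Complex.ext
    · simp [real_inner_comm]
    · simp [real_inner_comm]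
  add_left z w v := by
    simp only [inner_def]
    apply Complex.ext
    · simp [inner_add_left]; ring
    · simp [inner_add_left]; ring
  smul_left z w c := by
    simp only [inner_def]
    apply Complex.ext
    · simp [inner_add_left, inner_sub_left, inner_smul_left]; ring
    · simp [inner_add_left, inner_sub_left, inner_smul_left]; ring

/-- The embedding `x ↦ x + i0` of `X` into its complexification. -/
def ofReal (x : X) : Complexification X := mk x 0

/-- The complexification `x + iy ↦ T x + i T y` of an everywhere defined operator. -/
def mapLinear (T : X →ₗ[ℝ] X) : Complexification X →ₗ[ℂ] Complexification X where
  toFun z := mk (T (re z)) (T (im z))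
  map_add' z w := by apply ext <;> simp
  map_smul' c z := by apply ext <;> simp

/-- The complexification `x + iy ↦ T x + i T y` of a possibly unbounded operator, on the domain
`D(T) + i D(T)`. -/
def mapLinearPMap (T : X →ₗ.[ℝ] X) : Complexification X →ₗ.[ℂ] Complexification X where
  domain :=
    { carrier := {z | re z ∈ T.domain ∧ im z ∈ T.domain}
      add_mem' := fun hz hw => ⟨T.domain.add_mem hz.1 hw.1, T.domain.add_mem hz.2 hw.2⟩
      zero_mem' := ⟨T.domain.zero_mem, T.domain.zero_mem⟩
      smul_mem' := fun c _ hz =>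
        ⟨T.domain.sub_mem (T.domain.smul_mem c.re hz.1) (T.domain.smul_mem c.im hz.2),
          T.domain.add_mem (T.domain.smul_mem c.re hz.2) (T.domain.smul_mem c.im hz.1)⟩ }
  toFun :=
    { toFun := fun z => mk (T ⟨re z, z.2.1⟩) (T ⟨im z, z.2.2⟩)
      map_add' := by
        intro z w
        apply ext
        · simp only [re_mk, re_add]; rw [← T.map_add]; rfl
        · simp only [im_mk, im_add]; rw [← T.map_add]; rfl
      map_smul' := by
        intro c z
        apply ext
        · simp only [re_mk, im_mk, re_smul, RingHom.id_apply]
          rw [← T.map_smul, ← T.map_smul, ← T.map_sub]; rfl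
        · simp only [re_mk, im_mk, im_smul, RingHom.id_apply]
          rw [← T.map_smul, ← T.map_smul, ← T.map_add]; rfl }

end Complexification

/-! ### The real Hamilton equation -/

section Hamilton

variable {X : Type*} [NormedAddCommGroup X] [InnerProductSpace ℝ X] [CompleteSpace X]

/-- The space `𝒱 = D(B^{1/2})`. It carries the norm `‖x‖ = ‖B^{1/2} x‖`, not that of `X`. -/
def EnergySpace (B : X →ₗ.[ℝ] X) : Type _ := (opSqrt B).domain

namespace EnergySpace

variable {B : X →ₗ.[ℝ] X}

instance : AddCommGroup (EnergySpace B) := inferInstanceAs (AddCommGroup (opSqrt B).domain)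

instance : Module ℝ (EnergySpace B) := inferInstanceAs (Module ℝ (opSqrt B).domain)

/-- The operator `Λ = B^{1/2}` as a map `𝒱 → X`. -/
def sqrtMap (B : X →ₗ.[ℝ] X) : EnergySpace B →ₗ[ℝ] X := (opSqrt B).toFun

/-- The inclusion of `𝒱` in `X`. -/
def incl (B : X →ₗ.[ℝ] X) : EnergySpace B →ₗ[ℝ] X := (opSqrt B).domain.subtype

instance : SeminormedAddCommGroup (EnergySpace B) :=
  SeminormedAddCommGroup.induced (EnergySpace B) X (sqrtMap B)

theorem norm_def (x : EnergySpace B) : ‖x‖ = ‖sqrtMap B x‖ := rfl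

/-- The Hamilton functional `½ ⟨B x, x⟩` for `x` in the form domain `𝒱`, where
`⟨B x, x⟩ = ⟨B^{1/2} x, B^{1/2} x⟩`. -/
def energy (B : X →ₗ.[ℝ] X) (x : EnergySpace B) : ℝ :=
  1 / 2 * inner ℝ (sqrtMap B x) (sqrtMap B x)

end EnergySpace

/-- `u` is a mild solution of `u' = J B u`, that is, `u(t) - u(0) = J B ∫_0^t u(s) ds` for all `t`,
where the integral has to lie in `D(B)`. As the embedding of `𝒱` in `X` is continuous, the
integral may be taken in `X`. -/
def IsMildSolution (J : X →L[ℝ] X) (B : X →ₗ.[ℝ] X) (u : C(ℝ, EnergySpace B)) : Prop :=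
  ∀ t : ℝ, ∃ h : (∫ s in (0 : ℝ)..t, EnergySpace.incl B (u s)) ∈ B.domain,
    EnergySpace.incl B (u t) - EnergySpace.incl B (u 0) = J (B ⟨_, h⟩)

/-- The selfadjoint operator `H = Λ i J Λ` in the complexification of `X`, where `Λ` is the
square root of the complexification of `B`. -/
def complexGenerator (J : X →L[ℝ] X) (B : X →ₗ.[ℝ] X) :
    Complexification X →ₗ.[ℂ] Complexification X :=
  schrodingerOp (opSqrt (Complexification.mapLinearPMap B))
    (Complexification.mapLinear (J : X →ₗ[ℝ] X))

/-- The real component of the restriction of `E` to `X`. -/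
def realComponent (E : ℝ → Complexification X →L[ℂ] Complexification X) (ω : ℝ) (x : X) : X :=
  (E ω (Complexification.ofReal x)).re

/-- The imaginary component of the restriction of `E` to `X`. -/
def imagComponent (E : ℝ → Complexification X →L[ℂ] Complexification X) (ω : ℝ) (x : X) : X :=
  (E ω (Complexification.ofReal x)).im

/-- If `B` has a nonnegative selfadjoint square root then the Hamilton functional on `D(B) ⊆ 𝒱`
is literally `½ ⟨B x, x⟩`. -/
theorem EnergySpace.energy_eq_of_graph {B : X →ₗ.[ℝ] X} (hB : ∃ S, IsPosSqrt B S)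
    (x : B.domain) : ∃ v : EnergySpace B, EnergySpace.incl B v = x ∧
      EnergySpace.energy B v = 1 / 2 * inner ℝ (B x) (x : X) := by
  have hS : IsPosSqrt B (opSqrt B) := Classical.epsilon_spec hB
  obtain ⟨z, hxz, hzy⟩ := (hS.sq x (B x)).1 (B.mem_graph x)
  obtain ⟨v, hv, hvz⟩ := (LinearPMap.mem_graph_iff _).1 hxz
  obtain ⟨w, hw, hwy⟩ := (LinearPMap.mem_graph_iff _).1 hzy
  have had : (opSqrt B).IsFormalAdjoint (opSqrt B) := by
    have h := LinearPMap.adjoint_isFormalAdjoint hS.selfAdjoint.dense_domain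
    rwa [show (opSqrt B).adjoint = opSqrt B from hS.selfAdjoint] at h
  refine ⟨v, hv, ?_⟩
  have h := had v w
  have h1 : EnergySpace.sqrtMap B v = z := hvz
  rw [hwy, hvz, hw, hv] at h
  change 1 / 2 * inner ℝ (EnergySpace.sqrtMap B v) (EnergySpace.sqrtMap B v) = _
  have h' : inner ℝ z z = inner ℝ (x : X) (B x) := h
  rw [h1, h', real_inner_comm]

end Hamilton

end

end HamiltonSpectral

open HamiltonSpectral

/-! With `Λ = B^{1/2}` and `y = Λ u`, the equation `u' = J B u` becomes `i q' = H q` for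
`q = y + i0` and `H = Λ i J Λ`. As `B` is invertible, so are `Λ` and `H`, with bounded selfadjoint
inverses: `R = Λ⁻¹` is the positive square root of `B⁻¹`, and `K = H⁻¹ = -i R J⁻¹ R`. Every
unbounded operator is therefore handled through its bounded inverse, and the spectral projections
of `H` are obtained from the continuous functional calculus of `K`.

Given any spectral resolution `E` of `H`, the truncation `(E b - E a) q` of a solution `q` solves an
ordinary differential equation with the bounded generator `-i ∫_a^b ω dE(ω)`, so that
`q t = ∫ exp (-i ω t) dE(ω) q 0`. This gives uniqueness, conservation of `‖q t‖ = ‖Λ (u t)‖`, and,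
by taking real parts, the formula with `cos` and `sin`. -/

namespace HamiltonSpectral

noncomputable section

section Inverse

variable {𝕜 E : Type*}

section Normed

variable [NormedField 𝕜] [NormedAddCommGroup E] [NormedSpace 𝕜 E]

/-- The unbounded operator `T` is the inverse of the everywhere defined operator `A`. -/
def IsInverseOf (T : E →ₗ.[𝕜] E) (A : E →L[𝕜] E) : Prop :=
  ∀ x y : E, (x, y) ∈ T.graph ↔ A y = x

variable {S T : E →ₗ.[𝕜] E} {A : E →L[𝕜] E}

theorem IsInverseOf.mem_graph (h : IsInverseOf T A) (y : E) : (A y, y) ∈ T.graph :=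
  (h _ _).2 rfl

theorem IsInverseOf.apply_apply (h : IsInverseOf T A) (x : T.domain) : A (T x) = x :=
  (h _ _).1 (T.mem_graph x)

theorem IsInverseOf.ext (hS : IsInverseOf S A) (hT : IsInverseOf T A) : S = T := by
  apply LinearPMap.eq_of_eq_graph
  ext ⟨x, y⟩
  rw [hS, hT]

theorem IsInverseOf.injective (h : IsInverseOf T A) : Function.Injective A :=
  (injective_iff_map_eq_zero A).2 fun y hy => T.graph_fst_eq_zero_snd ((h 0 y).2 hy) rfl

theorem IsInverseOf.bijective (h : IsInverseOf T A) : Function.Bijective T := by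
  refine ⟨fun x y hxy => Subtype.ext ?_, fun y => ?_⟩
  · rw [← h.apply_apply x, hxy, h.apply_apply y]
  · obtain ⟨x, -, hx⟩ := (LinearPMap.mem_graph_iff _).1 (h.mem_graph y)
    exact ⟨x, hx⟩

theorem exists_isInverseOf_of_injective (hA : Function.Injective A) : ∃ T, IsInverseOf T A := by
  let f : E →ₗ.[𝕜] E := (A : E →ₗ[𝕜] E).toPMap ⊤
  have hf : LinearMap.ker f.toFun = ⊥ := LinearMap.ker_eq_bot.2 fun x y h => Subtype.ext (hA h)
  have mem_graph (x y : E) : (y, x) ∈ f.graph ↔ A y = x := by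
    simp [f, LinearPMap.mem_graph_iff]
  refine ⟨f.inverse, fun x y => ?_⟩
  simp [LinearPMap.inverse_graph hf, mem_graph]

end Normed

section InnerProduct

variable [RCLike 𝕜] [NormedAddCommGroup E] [InnerProductSpace 𝕜 E]
variable {S T : E →ₗ.[𝕜] E} {A : E →L[𝕜] E}

theorem IsInverseOf.isNonneg_iff (h : IsInverseOf T A) (hA : (A : E →ₗ[𝕜] E).IsSymmetric) :
    IsNonneg T ↔ A.IsPositive := by
  have hinner (x y : E) : inner 𝕜 (A x) y = inner 𝕜 x (A y) := hA x y
  constructor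
  · intro hT
    refine ⟨hA, fun y => ?_⟩
    obtain ⟨x, rfl⟩ := h.bijective.2 y
    rw [ContinuousLinearMap.reApplyInnerSelf_apply, hinner, h.apply_apply]
    exact hT x
  · intro hA x
    have hTx := hA.2 (T x)
    rwa [ContinuousLinearMap.reApplyInnerSelf_apply, hinner, h.apply_apply] at hTx

variable [CompleteSpace E]

theorem isFormalAdjoint_of_isSelfAdjoint (hT : IsSelfAdjoint T) : T.IsFormalAdjoint T := by
  have h := LinearPMap.adjoint_isFormalAdjoint hT.dense_domain
  rwa [show T.adjoint = T from hT] at h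

theorem exists_isSymmetric_isInverseOf (hT : T.IsFormalAdjoint T) (hbij : Function.Bijective T) :
    ∃ A : E →L[𝕜] E, (A : E →ₗ[𝕜] E).IsSymmetric ∧ IsInverseOf T A := by
  let e : T.domain ≃ₗ[𝕜] E := LinearEquiv.ofBijective T.toFun hbij
  have he (y : E) : T (e.symm y) = y := e.apply_symm_apply y
  let L : E →ₗ[𝕜] E := T.domain.subtype ∘ₗ (e.symm : E →ₗ[𝕜] T.domain)
  have hL : L.IsSymmetric := fun x y => by
    have h := hT (e.symm x) (e.symm y)
    rw [he, he] at h
    exact h.symm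
  refine ⟨⟨L, hL.continuous⟩, hL, fun x y => ?_⟩
  rw [LinearPMap.mem_graph_iff]
  constructor
  · rintro ⟨c, rfl, rfl⟩
    exact congrArg Subtype.val (e.symm_apply_apply c)
  · rintro rfl
    exact ⟨e.symm y, rfl, he y⟩

theorem exists_isPositive_isInverseOf (hT : IsSelfAdjoint T) (hT₀ : IsNonneg T)
    (hbij : Function.Bijective T) : ∃ A : E →L[𝕜] E, A.IsPositive ∧ IsInverseOf T A := by
  obtain ⟨A, hA, hTA⟩ :=
    exists_isSymmetric_isInverseOf (isFormalAdjoint_of_isSelfAdjoint hT) hbij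
  exact ⟨A, (hTA.isNonneg_iff hA).1 hT₀, hTA⟩

theorem IsInverseOf.dense_domain (h : IsInverseOf T A) (hA : (A : E →ₗ[𝕜] E).IsSymmetric) :
    Dense (T.domain : Set E) := by
  rw [Submodule.dense_iff_topologicalClosure_eq_top, Submodule.topologicalClosure_eq_top_iff,
    Submodule.eq_bot_iff]
  intro x hx
  have horth : inner 𝕜 (A (A x)) x = 0 :=
    (Submodule.mem_orthogonal _ _).1 hx _ (LinearPMap.mem_domain_of_mem_graph (h.mem_graph _))
  apply h.injective
  rw [map_zero, ← inner_self_eq_zero (𝕜 := 𝕜)]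
  rwa [show inner 𝕜 (A (A x)) x = inner 𝕜 (A x) (A x) from hA _ _] at horth

theorem IsInverseOf.isSelfAdjoint (h : IsInverseOf T A) (hA : (A : E →ₗ[𝕜] E).IsSymmetric) :
    IsSelfAdjoint T := by
  have hinner (x y : E) : inner 𝕜 (A x) y = inner 𝕜 x (A y) := hA x y
  apply LinearPMap.eq_of_eq_graph
  change T.adjoint.graph = T.graph
  rw [LinearPMap.adjoint_graph_eq_graph_adjoint (h.dense_domain hA)]
  ext ⟨x, y⟩
  rw [Submodule.mem_adjoint_iff, h]
  constructor
  · intro hxy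
    refine ext_inner_left 𝕜 fun v => ?_
    rw [← hinner, ← sub_eq_zero.1 (hxy (A v) v (h.mem_graph v))]
  · rintro rfl a b hab
    obtain rfl := (h _ _).1 hab
    rw [sub_eq_zero, hinner]

theorem IsPosSqrt.bijective (hS : IsPosSqrt T S) (hT : Function.Bijective T) :
    Function.Bijective S := by
  constructor
  · refine (injective_iff_map_eq_zero S.toFun).2 fun x hx => ?_
    have hxT : ((x : E), (0 : E)) ∈ T.graph :=
      (hS.sq x 0).2 ⟨0, (LinearPMap.mem_graph_iff _).2 ⟨x, rfl, hx⟩, S.graph.zero_mem⟩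
    obtain ⟨c, hcx, hc⟩ := (LinearPMap.mem_graph_iff _).1 hxT
    have hc₀ : c = 0 := hT.1 (hc.trans T.map_zero.symm)
    exact Subtype.ext (hcx.symm.trans (congrArg Subtype.val hc₀))
  · intro y
    obtain ⟨x, rfl⟩ := hT.2 y
    obtain ⟨z, -, hz⟩ := (hS.sq _ _).1 (T.mem_graph x)
    obtain ⟨c, -, hc⟩ := (LinearPMap.mem_graph_iff _).1 hz
    exact ⟨c, hc⟩

theorem isPosSqrt_iff (h : IsInverseOf T A) :
    IsPosSqrt T S ↔ ∃ Q : E →L[𝕜] E, Q.IsPositive ∧ Q * Q = A ∧ IsInverseOf S Q := by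
  constructor
  · intro hS
    obtain ⟨Q, hQ, hSQ⟩ :=
      exists_isPositive_isInverseOf hS.selfAdjoint hS.nonneg (hS.bijective h.bijective)
    refine ⟨Q, hQ, ContinuousLinearMap.ext fun y => ?_, hSQ⟩
    exact ((h _ _).1 ((hS.sq _ _).2 ⟨Q y, hSQ.mem_graph _, hSQ.mem_graph _⟩)).symm
  · rintro ⟨Q, hQ, rfl, hSQ⟩
    refine ⟨hSQ.isSelfAdjoint hQ.isSymmetric, (hSQ.isNonneg_iff hQ.isSymmetric).2 hQ,
      fun x y => ?_⟩
    rw [h]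
    constructor
    · rintro rfl
      exact ⟨Q y, hSQ.mem_graph _, hSQ.mem_graph _⟩
    · rintro ⟨z, hxz, hzy⟩
      rw [← (hSQ _ _).1 hxz, ← (hSQ _ _).1 hzy]
      rfl

theorem existsUnique_isPosSqrt (h : IsInverseOf T A)
    (hA : ∃! Q : E →L[𝕜] E, Q.IsPositive ∧ Q * Q = A) : ∃! S, IsPosSqrt T S := by
  obtain ⟨Q, ⟨hQ, hQA⟩, huniq⟩ := hA
  have hinj : Function.Injective Q := fun x y hxy => h.injective (by
    rw [← hQA]
    exact congrArg Q hxy)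
  obtain ⟨S, hS⟩ := exists_isInverseOf_of_injective hinj
  refine ⟨S, (isPosSqrt_iff h).2 ⟨Q, hQ, hQA, hS⟩, fun S' hS' => ?_⟩
  obtain ⟨Q', hQ', hQA', hSQ'⟩ := (isPosSqrt_iff h).1 hS'
  obtain rfl := huniq Q' ⟨hQ', hQA'⟩
  exact hSQ'.ext hS

end InnerProduct

end Inverse

namespace Complexification

variable {X : Type*} [NormedAddCommGroup X]

@[simp] theorem re_ofReal (x : X) : re (ofReal x) = x := rfl
@[simp] theorem im_ofReal (x : X) : im (ofReal x) = 0 := rfl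

/-- Complex conjugation `x + iy ↦ x - iy`. -/
def conj (z : Complexification X) : Complexification X := mk (re z) (-im z)

@[simp] theorem re_conj (z : Complexification X) : re (conj z) = re z := rfl
@[simp] theorem im_conj (z : Complexification X) : im (conj z) = -im z := rfl

variable [InnerProductSpace ℝ X]

theorem re_real_smul (r : ℝ) (z : Complexification X) : re (r • z) = r • re z := by
  rw [← Complex.coe_smul, re_smul]
  simp

theorem im_real_smul (r : ℝ) (z : Complexification X) : im (r • z) = r • im z := by
  rw [← Complex.coe_smul, im_smul]
  simp

theorem norm_re_le (z : Complexification X) : ‖re z‖ ≤ ‖z‖ := by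
  refine le_of_sq_le_sq ?_ (norm_nonneg z)
  rw [norm_sq]
  exact le_add_of_nonneg_right (sq_nonneg _)

theorem norm_im_le (z : Complexification X) : ‖im z‖ ≤ ‖z‖ := by
  refine le_of_sq_le_sq ?_ (norm_nonneg z)
  rw [norm_sq]
  exact le_add_of_nonneg_left (sq_nonneg _)

/-- The real part as a continuous real linear map. -/
def reCLM : Complexification X →L[ℝ] X :=
  LinearMap.mkContinuous ⟨⟨re, re_add⟩, re_real_smul⟩ 1 fun z => (one_mul ‖z‖).symm ▸ norm_re_le z

/-- The imaginary part as a continuous real linear map. -/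
def imCLM : Complexification X →L[ℝ] X :=
  LinearMap.mkContinuous ⟨⟨im, im_add⟩, im_real_smul⟩ 1 fun z => (one_mul ‖z‖).symm ▸ norm_im_le z

@[simp] theorem re_sub (z w : Complexification X) : re (z - w) = re z - re w := reCLM.map_sub z w
@[simp] theorem re_neg (z : Complexification X) : re (-z) = -re z := reCLM.map_neg z
@[simp] theorem im_neg (z : Complexification X) : im (-z) = -im z := imCLM.map_neg z

theorem eq_ofReal_re_add_I_smul (z : Complexification X) :
    z = ofReal (re z) + Complex.I • ofReal (im z) := by
  apply ext <;> simp

theorem norm_ofReal (x : X) : ‖ofReal x‖ = ‖x‖ := by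
  rw [← sq_eq_sq₀ (norm_nonneg _) (norm_nonneg _), norm_sq]
  simp

/-- The embedding of `X` in its complexification as a continuous real linear map. -/
def ofRealCLM : X →L[ℝ] Complexification X :=
  LinearMap.mkContinuous
    ⟨⟨ofReal, fun x y => by apply ext <;> simp⟩,
      fun r x => by apply ext <;> simp [re_real_smul, im_real_smul]⟩
    1 fun x => ((norm_ofReal x).trans (one_mul ‖x‖).symm).le

/-- The complexification of a bounded operator, as a bounded operator. -/
def mapCLM (T : X →L[ℝ] X) : Complexification X →L[ℂ] Complexification X :=
  LinearMap.mkContinuous (mapLinear (T : X →ₗ[ℝ] X)) ‖T‖ fun z => by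
    refine le_of_sq_le_sq ?_ (by positivity)
    rw [norm_sq, mul_pow, norm_sq z, mul_add, ← mul_pow, ← mul_pow]
    exact add_le_add (pow_le_pow_left₀ (norm_nonneg _) (T.le_opNorm _) 2)
      (pow_le_pow_left₀ (norm_nonneg _) (T.le_opNorm _) 2)

@[simp] theorem re_mapCLM (T : X →L[ℝ] X) (z : Complexification X) :
    re (mapCLM T z) = T (re z) := rfl
@[simp] theorem im_mapCLM (T : X →L[ℝ] X) (z : Complexification X) :
    im (mapCLM T z) = T (im z) := rfl

theorem mapCLM_ofReal (T : X →L[ℝ] X) (x : X) : mapCLM T (ofReal x) = ofReal (T x) := by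
  apply ext <;> simp

theorem mapCLM_injective : Function.Injective (mapCLM (X := X)) := fun S T h => by
  ext x
  exact congrArg re (DFunLike.congr_fun h (ofReal x))

theorem mapCLM_mul (S T : X →L[ℝ] X) : mapCLM (S * T) = mapCLM S * mapCLM T := rfl

theorem isPositive_mapCLM_iff {T : X →L[ℝ] X} : (mapCLM T).IsPositive ↔ T.IsPositive := by
  have hre (z : Complexification X) : (mapCLM T).reApplyInnerSelf z =
      T.reApplyInnerSelf (re z) + T.reApplyInnerSelf (im z) := rfl
  constructor
  · rintro ⟨hsymm, hnonneg⟩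
    refine ⟨fun x y => ?_, fun x => ?_⟩
    · simpa [inner_def] using congrArg Complex.re (hsymm (ofReal x) (ofReal y))
    · simpa [hre, ContinuousLinearMap.reApplyInnerSelf_apply] using hnonneg (ofReal x)
  · rintro ⟨hsymm, hnonneg⟩
    have hinner (x y : X) : inner ℝ (T x) y = inner ℝ x (T y) := hsymm x y
    refine ⟨fun z w => ?_, fun z => (hre z).symm ▸ add_nonneg (hnonneg _) (hnonneg _)⟩
    change inner ℂ (mapCLM T z) w = inner ℂ z (mapCLM T w)
    simp [inner_def, hinner]

@[simp] theorem conj_conj (z : Complexification X) : conj (conj z) = z := by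
  apply ext <;> simp

theorem conj_add (z w : Complexification X) : conj (z + w) = conj z + conj w := by
  apply ext <;> simp [add_comm]

theorem conj_smul (c : ℂ) (z : Complexification X) :
    conj (c • z) = starRingEnd ℂ c • conj z := by
  apply ext <;> simp [add_comm, sub_eq_add_neg]

theorem norm_conj (z : Complexification X) : ‖conj z‖ = ‖z‖ := by
  rw [← sq_eq_sq₀ (norm_nonneg _) (norm_nonneg _), norm_sq, norm_sq]
  simp

theorem inner_conj_conj (z w : Complexification X) : inner ℂ (conj z) (conj w) = inner ℂ w z := by
  rw [inner_def, inner_def]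
  apply Complex.ext <;> simp [real_inner_comm]
  ring

/-- The operator `z ↦ conj (Q (conj z))`, which is `Q` if and only if `Q` is the complexification
of a real operator. -/
def conjCLM (Q : Complexification X →L[ℂ] Complexification X) :
    Complexification X →L[ℂ] Complexification X :=
  LinearMap.mkContinuous
    { toFun := fun z => conj (Q (conj z))
      map_add' := fun z w => by rw [conj_add, map_add, conj_add]
      map_smul' := fun c z => by
        rw [conj_smul, map_smul, conj_smul, Complex.conj_conj, RingHom.id_apply] }
    ‖Q‖ fun z => by
      rw [LinearMap.coe_mk, AddHom.coe_mk, norm_conj, ← norm_conj z]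
      exact Q.le_opNorm _

@[simp] theorem conjCLM_apply (Q : Complexification X →L[ℂ] Complexification X)
    (z : Complexification X) : conjCLM Q z = conj (Q (conj z)) := rfl

theorem conjCLM_mapCLM (T : X →L[ℝ] X) : conjCLM (mapCLM T) = mapCLM T := by
  ext z
  apply ext <;> simp

theorem isPositive_conjCLM {Q : Complexification X →L[ℂ] Complexification X}
    (hQ : Q.IsPositive) : (conjCLM Q).IsPositive := by
  have hinner (z w : Complexification X) : inner ℂ (conj (Q (conj z))) w = inner ℂ z
      (conj (Q (conj w))) := by
    calc inner ℂ (conj (Q (conj z))) w = inner ℂ (conj w) (Q (conj z)) := by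
          rw [← inner_conj_conj, conj_conj]
      _ = inner ℂ (Q (conj w)) (conj z) := (hQ.isSymmetric _ _).symm
      _ = inner ℂ z (conj (Q (conj w))) := by rw [← inner_conj_conj, conj_conj]
  refine ⟨hinner, fun z => ?_⟩
  have h := hQ.2 (conj z)
  rw [ContinuousLinearMap.reApplyInnerSelf_apply] at h ⊢
  rwa [conjCLM_apply, hinner, ← inner_conj_conj, conj_conj]

theorem exists_mapCLM_eq {Q : Complexification X →L[ℂ] Complexification X}
    (hQ : conjCLM Q = Q) : ∃ T : X →L[ℝ] X, mapCLM T = Q := by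
  have him (x : X) : im (Q (ofReal x)) = 0 := by
    have hreal : conj (ofReal x) = ofReal x := by apply ext <;> simp
    have h : im (conjCLM Q (ofReal x)) = im (Q (ofReal x)) := by rw [hQ]
    rw [conjCLM_apply, im_conj, hreal] at h
    have := IsAddTorsionFree.of_isTorsionFree ℝ X
    exact self_eq_neg.1 h.symm
  refine ⟨reCLM.comp ((Q.restrictScalars ℝ).comp ofRealCLM), ?_⟩
  have hofReal (x : X) : ofReal (re (Q (ofReal x))) = Q (ofReal x) := ext rfl (him x).symm
  ext z
  rw [eq_ofReal_re_add_I_smul z, map_add, map_add, map_smul, map_smul, mapCLM_ofReal,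
    mapCLM_ofReal]
  exact congrArg₂ (· + Complex.I • ·) (hofReal _) (hofReal _)

end Complexification

open Complexification

theorem IsInverseOf.mapLinearPMap {X : Type*} [NormedAddCommGroup X] [InnerProductSpace ℝ X]
    {T : X →ₗ.[ℝ] X} {A : X →L[ℝ] X} (h : IsInverseOf T A) :
    IsInverseOf (Complexification.mapLinearPMap T) (mapCLM A) := by
  intro z w
  rw [LinearPMap.mem_graph_iff]
  constructor
  · rintro ⟨c, rfl, rfl⟩
    exact Complexification.ext (h.apply_apply ⟨_, c.2.1⟩) (h.apply_apply ⟨_, c.2.2⟩)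
  · rintro rfl
    obtain ⟨x, hx, hx'⟩ := (LinearPMap.mem_graph_iff _).1 (h.mem_graph (re w))
    obtain ⟨y, hy, hy'⟩ := (LinearPMap.mem_graph_iff _).1 (h.mem_graph (im w))
    exact ⟨⟨mk x y, x.2, y.2⟩, Complexification.ext hx hy, Complexification.ext hx' hy'⟩

section BoundedSqrt

theorem existsUnique_sqrt_complex {Y : Type*} [NormedAddCommGroup Y] [InnerProductSpace ℂ Y]
    [CompleteSpace Y] {A : Y →L[ℂ] Y} (hA : A.IsPositive) :
    ∃! Q : Y →L[ℂ] Y, Q.IsPositive ∧ Q * Q = A := by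
  simp only [← ContinuousLinearMap.nonneg_iff_isPositive] at hA ⊢
  exact ⟨CFC.sqrt A, ⟨CFC.sqrt_nonneg A, CFC.sqrt_mul_sqrt_self A⟩,
    fun Q hQ => (CFC.sqrt_unique hQ.2 hQ.1).symm⟩

-- The square root of a complexified operator is unique, hence invariant under conjugation.
theorem existsUnique_sqrt_real {X : Type*} [NormedAddCommGroup X] [InnerProductSpace ℝ X]
    [CompleteSpace X] {A : X →L[ℝ] X} (hA : A.IsPositive) :
    ∃! R : X →L[ℝ] X, R.IsPositive ∧ R * R = A := by
  obtain ⟨Q, ⟨hQ, hQA⟩, huniq⟩ := existsUnique_sqrt_complex (isPositive_mapCLM_iff.2 hA)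
  have hsq : conjCLM Q * conjCLM Q = mapCLM A := by
    rw [← conjCLM_mapCLM, ← hQA]
    ext z
    simp
  obtain ⟨R, rfl⟩ := exists_mapCLM_eq (huniq _ ⟨isPositive_conjCLM hQ, hsq⟩)
  refine ⟨R, ⟨isPositive_mapCLM_iff.1 hQ, mapCLM_injective hQA⟩, fun R' hR' => ?_⟩
  refine mapCLM_injective (huniq _ ⟨isPositive_mapCLM_iff.2 hR'.1, ?_⟩)
  rw [← mapCLM_mul, hR'.2]

end BoundedSqrt

/-- A tagged partition `a = x₀ ≤ ξ₀ ≤ x₁ ≤ ξ₁ ≤ … ≤ xₙ = b` of `[a, b]`. The values of `point`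
beyond `n = size` and of `tag` from `n` on are irrelevant. -/
structure TaggedPartition (a b : ℝ) where
  size : ℕ
  point : ℕ → ℝ
  tag : ℕ → ℝ
  point_zero : point 0 = a
  point_size : point size = b
  point_le_tag : ∀ i < size, point i ≤ tag i
  tag_le_point : ∀ i < size, tag i ≤ point (i + 1)

namespace TaggedPartition

variable {a b : ℝ}

theorem point_le_point (π : TaggedPartition a b) {i j : ℕ} (hij : i ≤ j) (hj : j ≤ π.size) :
    π.point i ≤ π.point j := by
  induction j, hij using Nat.le_induction with
  | base => exact le_rfl
  | succ k _ ih =>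
    exact (ih (by lia)).trans ((π.point_le_tag k hj).trans (π.tag_le_point k hj))

theorem left_le_point (π : TaggedPartition a b) {i : ℕ} (hi : i ≤ π.size) : a ≤ π.point i :=
  π.point_zero.symm.trans_le (π.point_le_point i.zero_le hi)

theorem point_le_right (π : TaggedPartition a b) {i : ℕ} (hi : i ≤ π.size) : π.point i ≤ b :=
  (π.point_le_point hi le_rfl).trans_eq π.point_size

theorem left_le_right (π : TaggedPartition a b) : a ≤ b :=
  (π.left_le_point le_rfl).trans_eq π.point_size

theorem tag_mem_Icc (π : TaggedPartition a b) {i : ℕ} (hi : i < π.size) :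
    π.tag i ∈ Set.Icc a b :=
  ⟨(π.left_le_point hi.le).trans (π.point_le_tag i hi),
    (π.tag_le_point i hi).trans (π.point_le_right hi)⟩

/-- The partition of `[a, b]` into `n + 1` intervals of equal length, tagged by their left
endpoints. -/
def uniform (hab : a ≤ b) (n : ℕ) : TaggedPartition a b where
  size := n + 1
  point i := a + i * ((b - a) / (n + 1))
  tag i := a + i * ((b - a) / (n + 1))
  point_zero := by simp
  point_size := by
    push_cast
    field_simp
    ring
  point_le_tag _ _ := le_rfl
  tag_le_point i _ := by
    have : 0 ≤ (b - a) / (n + 1) := div_nonneg (sub_nonneg.2 hab) (by positivity)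
    gcongr
    simp

end TaggedPartition

/-- The filter of tagged partitions of `[a, b]` whose mesh tends to zero. -/
def meshFilter (a b : ℝ) : Filter (TaggedPartition a b) :=
  ⨅ δ ∈ Set.Ioi (0 : ℝ), 𝓟 {π | ∀ i < π.size, π.point (i + 1) - π.point i < δ}

theorem hasBasis_meshFilter (a b : ℝ) : (meshFilter a b).HasBasis (fun δ : ℝ => 0 < δ)
    fun δ => {π | ∀ i < π.size, π.point (i + 1) - π.point i < δ} := by
  refine hasBasis_biInf_principal' (fun δ hδ δ' hδ' =>
    ⟨min δ δ', Set.mem_Ioi.2 (lt_min hδ hδ'), ?_, ?_⟩)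
    ⟨1, Set.mem_Ioi.2 one_pos⟩
  · exact fun π hπ i hi => (hπ i hi).trans_le (min_le_left _ _)
  · exact fun π hπ i hi => (hπ i hi).trans_le (min_le_right _ _)

theorem neBot_meshFilter {a b : ℝ} (hab : a ≤ b) : (meshFilter a b).NeBot := by
  refine (hasBasis_meshFilter a b).neBot_iff.2 fun {δ} hδ => ?_
  obtain ⟨n, hn⟩ := exists_nat_gt ((b - a) / δ)
  refine ⟨TaggedPartition.uniform hab n, fun i _ => ?_⟩
  have hlen : (b - a) / (n + 1) < δ := by
    rw [div_lt_iff₀ hδ] at hn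
    rw [div_lt_iff₀ (by positivity)]
    linarith
  calc a + ((i + 1 : ℕ) : ℝ) * ((b - a) / (n + 1)) - (a + i * ((b - a) / (n + 1)))
      = (b - a) / (n + 1) := by push_cast; ring
    _ < δ := hlen

section StieltjesSum

variable {𝕜 E : Type*} [NormedField 𝕜] [NormedAddCommGroup E] [NormedSpace 𝕜 E] {a b : ℝ}
  {f : ℝ → 𝕜} {F : ℝ → E}

/-- The Riemann–Stieltjes sum `∑ f (ξᵢ) (F (xᵢ₊₁) - F (xᵢ))`. -/
def stieltjesSum (f : ℝ → 𝕜) (F : ℝ → E) (π : TaggedPartition a b) : E :=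
  ∑ i ∈ Finset.range π.size, f (π.tag i) • (F (π.point (i + 1)) - F (π.point i))

/-- The Riemann–Stieltjes integral `∫_a^b f dF`; it is a junk value if the integral does not exist
or `b < a`. -/
def stieltjesIntegral (f : ℝ → 𝕜) (F : ℝ → E) (a b : ℝ) : E :=
  limUnder (meshFilter a b) (stieltjesSum f F)

theorem hasStieltjesIntegralOn_iff_tendsto {I : E} :
    HasStieltjesIntegralOn f F a b I ↔ Tendsto (stieltjesSum f F) (meshFilter a b) (𝓝 I) := by
  simp only [((hasBasis_meshFilter a b).tendsto_iff Metric.nhds_basis_ball), Metric.mem_ball,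
    dist_eq_norm]
  refine forall₂_congr fun ε _ => exists_congr fun δ => and_congr_right fun _ => ?_
  constructor
  · exact fun h π hπ => h π.size π.point π.tag π.point_zero π.point_size fun i hi =>
      ⟨π.point_le_tag i hi, π.tag_le_point i hi, hπ i hi⟩
  · exact fun h n x ξ ha hb hx => h ⟨n, x, ξ, ha, hb, fun i hi => (hx i hi).1,
      fun i hi => (hx i hi).2.1⟩ fun i hi => (hx i hi).2.2

theorem stieltjesIntegral_eq {I : E} (hab : a ≤ b)
    (h : Tendsto (stieltjesSum f F) (meshFilter a b) (𝓝 I)) : stieltjesIntegral f F a b = I :=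
  have := neBot_meshFilter hab
  h.limUnder_eq

theorem eventually_fst_le_snd : ∀ᶠ p : ℝ × ℝ in atBot ×ˢ atTop, p.1 ≤ p.2 :=
  ((eventually_le_atBot (0 : ℝ)).prod_mk (eventually_ge_atTop (0 : ℝ))).mono
    fun _ hp => hp.1.trans hp.2

theorem hasStieltjesIntegral_iff_tendsto {I : E}
    (h : ∀ a b : ℝ, a ≤ b → HasStieltjesIntegralOn f F a b (stieltjesIntegral f F a b)) :
    HasStieltjesIntegral f F I ↔
      Tendsto (fun p : ℝ × ℝ => stieltjesIntegral f F p.1 p.2) (atBot ×ˢ atTop) (𝓝 I) := by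
  refine ⟨fun ⟨G, hG, hGI⟩ => hGI.congr' ?_, fun hI => ⟨_, h, hI⟩⟩
  filter_upwards [eventually_fst_le_snd] with p hp
  exact (stieltjesIntegral_eq hp (hasStieltjesIntegralOn_iff_tendsto.1 (hG _ _ hp))).symm

theorem map_stieltjesSum {E' : Type*} [NormedAddCommGroup E'] [NormedSpace 𝕜 E']
    (L : E →L[𝕜] E') (π : TaggedPartition a b) :
    L (stieltjesSum f F π) = stieltjesSum f (fun ω => L (F ω)) π := by
  simp only [stieltjesSum, map_sum, map_smul, map_sub]

theorem HasStieltjesIntegralOn.map {E' : Type*} [NormedAddCommGroup E'] [NormedSpace 𝕜 E'] {I : E}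
    (h : HasStieltjesIntegralOn f F a b I) (L : E →L[𝕜] E') :
    HasStieltjesIntegralOn f (fun ω => L (F ω)) a b (L I) := by
  rw [hasStieltjesIntegralOn_iff_tendsto] at h ⊢
  exact ((L.continuous.tendsto I).comp h).congr (map_stieltjesSum L)

theorem HasStieltjesIntegral.map {E' : Type*} [NormedAddCommGroup E'] [NormedSpace 𝕜 E'] {I : E}
    (h : HasStieltjesIntegral f F I) (L : E →L[𝕜] E') :
    HasStieltjesIntegral f (fun ω => L (F ω)) (L I) := by
  obtain ⟨G, hG, hGI⟩ := h
  exact ⟨fun a b => L (G a b), fun a b hab => (hG a b hab).map L, (L.continuous.tendsto I).comp hGI⟩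

end StieltjesSum

theorem HasStieltjesIntegral.of_ofReal {E : Type*} [NormedAddCommGroup E] [NormedSpace ℂ E]
    {f : ℝ → ℝ} {F : ℝ → E} {I : E} (h : HasStieltjesIntegral (fun ω => (f ω : ℂ)) F I) :
    HasStieltjesIntegral f F I := by
  simpa only [HasStieltjesIntegral, HasStieltjesIntegralOn, Complex.coe_smul] using h

section OrthogonalSum

variable {𝕜 Y ι : Type*} [RCLike 𝕜] [NormedAddCommGroup Y] [InnerProductSpace 𝕜 Y] {s : Finset ι}

theorem norm_sum_sq_of_orthogonal {u : ι → Y}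
    (hu : (s : Set ι).Pairwise fun i j => inner 𝕜 (u i) (u j) = 0) :
    ‖∑ i ∈ s, u i‖ ^ 2 = ∑ i ∈ s, ‖u i‖ ^ 2 := by
  have h : inner 𝕜 (∑ i ∈ s, u i) (∑ i ∈ s, u i) = ∑ i ∈ s, inner 𝕜 (u i) (u i) := by
    rw [sum_inner]
    refine Finset.sum_congr rfl fun i hi => ?_
    rw [inner_sum]
    exact Finset.sum_eq_single_of_mem i hi fun j hj hij => hu hi hj hij.symm
  simp only [inner_self_eq_norm_sq_to_K] at h
  exact_mod_cast h

theorem norm_sum_le_of_orthogonal {u v : ι → Y} {c : ℝ} (hc : 0 ≤ c)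
    (hu : (s : Set ι).Pairwise fun i j => inner 𝕜 (u i) (u j) = 0)
    (hv : (s : Set ι).Pairwise fun i j => inner 𝕜 (v i) (v j) = 0)
    (h : ∀ i ∈ s, ‖u i‖ ≤ c * ‖v i‖) : ‖∑ i ∈ s, u i‖ ≤ c * ‖∑ i ∈ s, v i‖ := by
  refine le_of_sq_le_sq ?_ (by positivity)
  rw [mul_pow, norm_sum_sq_of_orthogonal hu, norm_sum_sq_of_orthogonal hv, Finset.mul_sum]
  refine Finset.sum_le_sum fun i hi => ?_
  rw [← mul_pow]
  exact pow_le_pow_left₀ (norm_nonneg _) (h i hi) 2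

variable [CompleteSpace Y]

theorem inner_apply_apply_eq_zero {P Q : Y →L[𝕜] Y} (hP : IsStarProjection P)
    (hPQ : P * Q = 0) (y z : Y) : inner 𝕜 (P y) (Q z) = 0 := by
  rw [show inner 𝕜 (P y) (Q z) = inner 𝕜 y (P (Q z)) from hP.isSelfAdjoint.isSymmetric y (Q z)]
  exact (congrArg (inner 𝕜 y) (DFunLike.congr_fun hPQ z)).trans (inner_zero_right y)

theorem norm_sum_smul_le_of_isStarProjection {P : ι → Y →L[𝕜] Y} {c : ι → 𝕜} {ε : ℝ} (hε : 0 ≤ ε)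
    (hP : ∀ i ∈ s, IsStarProjection (P i)) (hP₀ : (s : Set ι).Pairwise fun i j => P i * P j = 0)
    (hc : ∀ i ∈ s, P i ≠ 0 → ‖c i‖ ≤ ε) : ‖∑ i ∈ s, c i • P i‖ ≤ ε * ‖∑ i ∈ s, P i‖ := by
  refine ContinuousLinearMap.opNorm_le_bound _ (by positivity) fun z => ?_
  have horth : (s : Set ι).Pairwise fun i j => inner 𝕜 (P i z) (P j z) = 0 := fun i hi j hj hij =>
    inner_apply_apply_eq_zero (hP i hi) (hP₀ hi hj hij) z z
  calc ‖(∑ i ∈ s, c i • P i) z‖ = ‖∑ i ∈ s, c i • P i z‖ := by simp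
    _ ≤ ε * ‖∑ i ∈ s, P i z‖ := by
        refine norm_sum_le_of_orthogonal hε (fun i hi j hj hij => ?_) horth fun i hi => ?_
        · simp only [inner_smul_left, inner_smul_right, horth hi hj hij, mul_zero]
        · rw [norm_smul]
          by_cases hPi : P i = 0
          · simp [hPi]
          · exact mul_le_mul_of_nonneg_right (hc i hi hPi) (norm_nonneg _)
    _ = ε * ‖(∑ i ∈ s, P i) z‖ := by simp
    _ ≤ ε * ‖∑ i ∈ s, P i‖ * ‖z‖ := by
        rw [mul_assoc]
        exact mul_le_mul_of_nonneg_left (ContinuousLinearMap.le_opNorm _ _) hε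

end OrthogonalSum

/-- A monotone family of projections in a star ring. -/
structure IsProjectionFamily {A : Type*} [Mul A] [Star A] (E : ℝ → A) : Prop where
  isStarProjection : ∀ ω, IsStarProjection (E ω)
  mul_of_le : ∀ ⦃ω ω' : ℝ⦄, ω ≤ ω' → E ω * E ω' = E ω

/-- The increment `E b - E a`, for a projection family the projection that belongs to the
interval `(a, b]`. -/
def increment {A : Type*} [Sub A] (E : ℝ → A) (a b : ℝ) : A := E b - E a

namespace IsProjectionFamily

section Ring

variable {A : Type*} [Ring A] [StarRing A] {E : ℝ → A} {a b c d : ℝ}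

theorem mul_eq (hE : IsProjectionFamily E) (a b : ℝ) : E a * E b = E (min a b) := by
  rcases le_total a b with hab | hba
  · rw [hE.mul_of_le hab, min_eq_left hab]
  · rw [min_eq_right hba]
    have h := congrArg star (hE.mul_of_le hba)
    rwa [star_mul, (hE.isStarProjection a).isSelfAdjoint.star_eq,
      (hE.isStarProjection b).isSelfAdjoint.star_eq] at h

theorem commute (hE : IsProjectionFamily E) (a b : ℝ) : Commute (E a) (E b) := by
  rw [Commute, SemiconjBy, hE.mul_eq, hE.mul_eq, min_comm]

theorem commute_increment (hE : IsProjectionFamily E) (a b c d : ℝ) :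
    Commute (increment E a b) (increment E c d) :=
  ((hE.commute b d).sub_right (hE.commute b c)).sub_left
    ((hE.commute a d).sub_right (hE.commute a c))

theorem isStarProjection_increment (hE : IsProjectionFamily E) (hab : a ≤ b) :
    IsStarProjection (increment E a b) :=
  (hE.isStarProjection a).sub_of_mul_eq_left (hE.isStarProjection b) (hE.mul_of_le hab)

theorem increment_mul_increment_of_subset (hE : IsProjectionFamily E) (hac : a ≤ c) (hcd : c ≤ d)
    (hdb : d ≤ b) : increment E a b * increment E c d = increment E c d := by
  simp only [increment, sub_mul, mul_sub, hE.mul_eq, min_eq_right hdb, min_eq_right (hcd.trans hdb),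
    min_eq_left hac, min_eq_left (hac.trans hcd), sub_sub_sub_cancel_right]

theorem increment_mul_increment_of_le (hE : IsProjectionFamily E) (hab : a ≤ b) (hbc : b ≤ c)
    (hcd : c ≤ d) : increment E a b * increment E c d = 0 := by
  simp only [increment, sub_mul, mul_sub, hE.mul_eq, min_eq_left hbc, min_eq_left (hbc.trans hcd),
    min_eq_left (hab.trans hbc), min_eq_left (hab.trans (hbc.trans hcd)), sub_self]

theorem increment_mul_increment_of_ge (hE : IsProjectionFamily E) (hcd : c ≤ d) (hda : d ≤ a)
    (hab : a ≤ b) : increment E a b * increment E c d = 0 := by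
  rw [(hE.commute_increment a b c d).eq, hE.increment_mul_increment_of_le hcd hda hab]

theorem increment_point_mul_increment_point (hE : IsProjectionFamily E) (π : TaggedPartition a b)
    {i j : ℕ} (hi : i < π.size) (hj : j < π.size) (hij : i ≠ j) :
    increment E (π.point i) (π.point (i + 1)) * increment E (π.point j) (π.point (j + 1)) = 0 := by
  have hstep {k : ℕ} (hk : k < π.size) : π.point k ≤ π.point (k + 1) :=
    π.point_le_point k.le_succ hk
  rcases hij.lt_or_gt with hij | hji
  · exact hE.increment_mul_increment_of_le (hstep hi) (π.point_le_point hij hj.le) (hstep hj)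
  · exact hE.increment_mul_increment_of_ge (hstep hj) (π.point_le_point hji hi.le) (hstep hi)

end Ring

end IsProjectionFamily

theorem sum_increment {A : Type*} [AddCommGroup A] (E : ℝ → A) {a b : ℝ}
    (π : TaggedPartition a b) :
    ∑ i ∈ Finset.range π.size, increment E (π.point i) (π.point (i + 1)) = increment E a b := by
  have h := Finset.sum_range_sub (fun i => E (π.point i)) π.size
  rwa [π.point_zero, π.point_size] at h

section StieltjesProjection

variable {Y : Type*} [NormedAddCommGroup Y] [InnerProductSpace ℂ Y] [CompleteSpace Y]
  {E : ℝ → Y →L[ℂ] Y} {f g : ℝ → ℂ} {a b c d : ℝ}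

theorem stieltjesSum_one (E : ℝ → Y →L[ℂ] Y) (π : TaggedPartition a b) :
    stieltjesSum (1 : ℝ → ℂ) E π = increment E a b := by
  simp only [stieltjesSum, Pi.one_apply, one_smul]
  exact sum_increment E π

theorem stieltjesSum_sub (f g : ℝ → ℂ) (E : ℝ → Y →L[ℂ] Y) (π : TaggedPartition a b) :
    stieltjesSum (f - g) E π = stieltjesSum f E π - stieltjesSum g E π := by
  simp only [stieltjesSum, Pi.sub_apply, sub_smul, Finset.sum_sub_distrib]

theorem stieltjesSum_smul (k : ℂ) (f : ℝ → ℂ) (E : ℝ → Y →L[ℂ] Y) (π : TaggedPartition a b) :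
    stieltjesSum (k • f) E π = k • stieltjesSum f E π := by
  simp only [stieltjesSum, Pi.smul_apply, smul_assoc, Finset.smul_sum]

theorem commute_stieltjesSum {T : Y →L[ℂ] Y} (hT : ∀ ω, Commute T (E ω)) (f : ℝ → ℂ)
    (π : TaggedPartition a b) : Commute T (stieltjesSum f E π) :=
  Commute.sum_right _ _ _ fun i _ =>
    ((hT (π.point (i + 1))).sub_right (hT (π.point i))).smul_right _

namespace IsProjectionFamily

theorem norm_increment_le_one (hE : IsProjectionFamily E) (hab : a ≤ b) : ‖increment E a b‖ ≤ 1 :=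
  IsStarProjection.norm_le _ (hE.isStarProjection_increment hab)

theorem increment_point_mul_increment (hE : IsProjectionFamily E) (π : TaggedPartition a b)
    (hca : c ≤ a) (hbd : b ≤ d) {i : ℕ} (hi : i < π.size) :
    increment E c d * increment E (π.point i) (π.point (i + 1)) =
      increment E (π.point i) (π.point (i + 1)) :=
  hE.increment_mul_increment_of_subset (hca.trans (π.left_le_point hi.le))
    (π.point_le_point i.le_succ hi) ((π.point_le_right hi).trans hbd)

theorem stieltjesSum_mul (hE : IsProjectionFamily E) (f g : ℝ → ℂ) (π : TaggedPartition a b) :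
    stieltjesSum (f * g) E π = stieltjesSum f E π * stieltjesSum g E π := by
  simp only [stieltjesSum, Finset.sum_mul_sum]
  refine Finset.sum_congr rfl fun i hi => ?_
  rw [Finset.sum_eq_single_of_mem i hi fun j hj hji => ?_]
  · rw [smul_mul_smul_comm, Pi.mul_apply]
    congr 1
    exact (hE.isStarProjection_increment (π.point_le_point i.le_succ
      (Finset.mem_range.1 hi))).isIdempotentElem.eq.symm
  · rw [smul_mul_smul_comm]
    exact (congrArg _ (hE.increment_point_mul_increment_point π (Finset.mem_range.1 hi)
      (Finset.mem_range.1 hj) hji.symm)).trans (smul_zero _)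

theorem norm_stieltjesSum_le (hE : IsProjectionFamily E) {C : ℝ} (hC : 0 ≤ C)
    (hf : ∀ ω ∈ Set.Icc a b, ‖f ω‖ ≤ C) (π : TaggedPartition a b) :
    ‖stieltjesSum f E π‖ ≤ C := by
  calc ‖stieltjesSum f E π‖ ≤
        C * ‖∑ i ∈ Finset.range π.size, increment E (π.point i) (π.point (i + 1))‖ :=
        norm_sum_smul_le_of_isStarProjection hC
          (fun i hi => hE.isStarProjection_increment
            (π.point_le_point i.le_succ (Finset.mem_range.1 hi)))
          (fun i hi j hj => hE.increment_point_mul_increment_point π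
            (Finset.mem_range.1 hi) (Finset.mem_range.1 hj))
          fun i hi _ => hf _ (π.tag_mem_Icc (Finset.mem_range.1 hi))
    _ ≤ C := by
        rw [sum_increment]
        exact mul_le_of_le_one_right hC (hE.norm_increment_le_one π.left_le_right)

theorem increment_mul_increment_eq_zero_or_overlap (hE : IsProjectionFamily E) (hab : a ≤ b)
    (hcd : c ≤ d) : increment E a b * increment E c d = 0 ∨ a ≤ d ∧ c ≤ b := by
  rcases le_or_gt a d with had | hda
  · rcases le_or_gt c b with hcb | hbc
    · exact Or.inr ⟨had, hcb⟩
    · exact Or.inl (hE.increment_mul_increment_of_le hab hbc.le hcd)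
  · exact Or.inl (hE.increment_mul_increment_of_ge hcd hda.le hab)

theorem norm_sum_smul_increment_mul_increment_le (hE : IsProjectionFamily E)
    (π : TaggedPartition c d) (ρ : TaggedPartition a b) {k : ℕ × ℕ → ℂ} {ε : ℝ} (hε : 0 ≤ ε)
    (hk : ∀ i < π.size, ∀ j < ρ.size, π.point i ≤ ρ.point (j + 1) →
      ρ.point j ≤ π.point (i + 1) → ‖k (i, j)‖ ≤ ε) :
    ‖∑ p ∈ Finset.range π.size ×ˢ Finset.range ρ.size,
      k p • (increment E (π.point p.1) (π.point (p.1 + 1)) *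
        increment E (ρ.point p.2) (ρ.point (p.2 + 1)))‖ ≤ ε := by
  have hπ {i : ℕ} (hi : i < π.size) := π.point_le_point i.le_succ hi
  have hρ {j : ℕ} (hj : j < ρ.size) := ρ.point_le_point j.le_succ hj
  refine (norm_sum_smul_le_of_isStarProjection hε (fun p hp => ?_) (fun p hp q hq hpq => ?_)
    fun p hp hne => ?_).trans (mul_le_of_le_one_right hε ?_)
  · obtain ⟨hi, hj⟩ := Finset.mem_product.1 hp
    exact (hE.isStarProjection_increment (hπ (Finset.mem_range.1 hi))).mul
      (hE.isStarProjection_increment (hρ (Finset.mem_range.1 hj))) (hE.commute_increment _ _ _ _)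
  · simp only [Finset.coe_product, Finset.coe_range, Set.mem_prod, Set.mem_Iio] at hp hq
    change _ * _ * (_ * _) = (0 : Y →L[ℂ] Y)
    rw [(hE.commute_increment _ _ _ _).mul_mul_mul_comm]
    by_cases hi : p.1 = q.1
    · rw [hE.increment_point_mul_increment_point ρ hp.2 hq.2 fun hj => hpq (Prod.ext hi hj),
        mul_zero]
    · rw [hE.increment_point_mul_increment_point π hp.1 hq.1 hi, zero_mul]
  · simp only [Finset.mem_product, Finset.mem_range] at hp
    obtain ⟨hl, hr⟩ :=
      (hE.increment_mul_increment_eq_zero_or_overlap (hπ hp.1) (hρ hp.2)).resolve_left hne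
    exact hk _ hp.1 _ hp.2 hl hr
  · rw [Finset.sum_product]
    simp only [← Finset.sum_mul_sum, sum_increment]
    refine (norm_mul_le _ _).trans (mul_le_one₀ ?_ (norm_nonneg _) ?_)
    · exact hE.norm_increment_le_one π.left_le_right
    · exact hE.norm_increment_le_one ρ.left_le_right

-- Both sums are refined by the products of the projections of the two partitions.
theorem norm_stieltjesSum_mul_increment_sub_le (hE : IsProjectionFamily E) (hca : c ≤ a)
    (hbd : b ≤ d) (π : TaggedPartition c d) (ρ : TaggedPartition a b) {ε : ℝ} (hε : 0 ≤ ε)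
    (hf : ∀ i < π.size, ∀ j < ρ.size, π.point i ≤ ρ.point (j + 1) →
      ρ.point j ≤ π.point (i + 1) → ‖f (π.tag i) - f (ρ.tag j)‖ ≤ ε) :
    ‖stieltjesSum f E π * increment E a b - stieltjesSum f E ρ‖ ≤ ε := by
  have hπ : stieltjesSum f E π * increment E a b =
      ∑ p ∈ Finset.range π.size ×ˢ Finset.range ρ.size, f (π.tag p.1) •
        (increment E (π.point p.1) (π.point (p.1 + 1)) *
          increment E (ρ.point p.2) (ρ.point (p.2 + 1))) := by
    rw [← sum_increment E ρ, stieltjesSum, Finset.sum_mul_sum, Finset.sum_product]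
    simp only [smul_mul_assoc]
    rfl
  have hρ : stieltjesSum f E ρ =
      ∑ p ∈ Finset.range π.size ×ˢ Finset.range ρ.size, f (ρ.tag p.2) •
        (increment E (π.point p.1) (π.point (p.1 + 1)) *
          increment E (ρ.point p.2) (ρ.point (p.2 + 1))) := by
    rw [Finset.sum_product_right]
    refine Finset.sum_congr rfl fun j hj => ?_
    simp only
    rw [← Finset.smul_sum, ← Finset.sum_mul, sum_increment,
      hE.increment_point_mul_increment ρ hca hbd (Finset.mem_range.1 hj)]
    rfl
  rw [hπ, hρ, ← Finset.sum_sub_distrib]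
  simp only [← sub_smul]
  exact hE.norm_sum_smul_increment_mul_increment_le π ρ hε hf

theorem tendsto_stieltjesSum_mul_increment_sub (hE : IsProjectionFamily E) (hf : Continuous f)
    (hca : c ≤ a) (hbd : b ≤ d) :
    Tendsto (fun p : TaggedPartition c d × TaggedPartition a b =>
      stieltjesSum f E p.1 * increment E a b - stieltjesSum f E p.2)
      (meshFilter c d ×ˢ meshFilter a b) (𝓝 0) := by
  refine Metric.tendsto_nhds.2 fun ε hε => ?_
  obtain ⟨δ, hδ, hfδ⟩ := Metric.uniformContinuousOn_iff.1
    (isCompact_Icc.uniformContinuousOn_of_continuous hf.continuousOn (s := Set.Icc c d))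
    (ε / 2) (half_pos hε)
  filter_upwards [prod_mem_prod ((hasBasis_meshFilter c d).mem_of_mem (half_pos hδ))
    ((hasBasis_meshFilter a b).mem_of_mem (half_pos hδ))] with ⟨π, ρ⟩ ⟨hπ, hρ⟩
  rw [dist_zero_right]
  refine (hE.norm_stieltjesSum_mul_increment_sub_le hca hbd π ρ (half_pos hε).le
    fun i hi j hj hij hji => ?_).trans_lt (half_lt_self hε)
  have hmesh := hπ i hi
  have hmesh' := hρ j hj
  have hdist : dist (π.tag i) (ρ.tag j) < δ := by
    rw [Real.dist_eq, abs_sub_lt_iff]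
    constructor <;> linarith [π.point_le_tag i hi, π.tag_le_point i hi, ρ.point_le_tag j hj,
      ρ.tag_le_point j hj]
  rw [← dist_eq_norm]
  exact (hfδ _ (π.tag_mem_Icc hi) _ (Set.Icc_subset_Icc hca hbd (ρ.tag_mem_Icc hj)) hdist).le

theorem tendsto_stieltjesSum (hE : IsProjectionFamily E) (hf : Continuous f) (hab : a ≤ b) :
    Tendsto (stieltjesSum f E) (meshFilter a b) (𝓝 (stieltjesIntegral f E a b)) := by
  have hself (π : TaggedPartition a b) :
      stieltjesSum f E π * increment E a b = stieltjesSum f E π := by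
    rw [← stieltjesSum_one E π, ← hE.stieltjesSum_mul, mul_one]
  have h := hE.tendsto_stieltjesSum_mul_increment_sub hf (le_refl a) (le_refl b)
  simp only [hself] at h
  have := neBot_meshFilter hab
  refine tendsto_nhds_limUnder (cauchy_map_iff_exists_tendsto.1 (cauchy_map_iff'.2 ?_))
  rw [Metric.uniformity_eq_comap_nhds_zero, tendsto_comap_iff]
  simpa only [Function.comp_def, dist_eq_norm, norm_zero] using h.norm

theorem stieltjesIntegral_mul_increment (hE : IsProjectionFamily E) (hf : Continuous f)
    (hca : c ≤ a) (hab : a ≤ b) (hbd : b ≤ d) :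
    stieltjesIntegral f E c d * increment E a b = stieltjesIntegral f E a b := by
  have := neBot_meshFilter hab
  have := neBot_meshFilter (hca.trans (hab.trans hbd))
  have hcd := hE.tendsto_stieltjesSum hf (hca.trans (hab.trans hbd))
  have hlim := ((hcd.mul_const (increment E a b)).comp (tendsto_fst (g := meshFilter a b))).sub
    ((hE.tendsto_stieltjesSum hf hab).comp tendsto_snd)
  exact sub_eq_zero.1
    (tendsto_nhds_unique hlim (hE.tendsto_stieltjesSum_mul_increment_sub hf hca hbd))

end IsProjectionFamily

end StieltjesProjection

section StieltjesProjection

variable {Y : Type*} [NormedAddCommGroup Y] [InnerProductSpace ℂ Y] [CompleteSpace Y]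
  {E : ℝ → Y →L[ℂ] Y} {f g : ℝ → ℂ} {a b c d : ℝ}

theorem stieltjesIntegral_one (E : ℝ → Y →L[ℂ] Y) (hab : a ≤ b) :
    stieltjesIntegral (1 : ℝ → ℂ) E a b = increment E a b :=
  stieltjesIntegral_eq hab (tendsto_const_nhds.congr fun π => (stieltjesSum_one E π).symm)

namespace IsProjectionFamily

theorem stieltjesIntegral_sub (hE : IsProjectionFamily E) (hf : Continuous f) (hg : Continuous g)
    (hab : a ≤ b) :
    stieltjesIntegral (f - g) E a b = stieltjesIntegral f E a b - stieltjesIntegral g E a b :=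
  stieltjesIntegral_eq hab (((hE.tendsto_stieltjesSum hf hab).sub
    (hE.tendsto_stieltjesSum hg hab)).congr fun π => (stieltjesSum_sub f g E π).symm)

theorem stieltjesIntegral_smul (hE : IsProjectionFamily E) (k : ℂ) (hf : Continuous f)
    (hab : a ≤ b) : stieltjesIntegral (k • f) E a b = k • stieltjesIntegral f E a b :=
  stieltjesIntegral_eq hab (((hE.tendsto_stieltjesSum hf hab).const_smul k).congr fun π =>
    (stieltjesSum_smul k f E π).symm)

theorem stieltjesIntegral_mul (hE : IsProjectionFamily E) (hf : Continuous f) (hg : Continuous g)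
    (hab : a ≤ b) :
    stieltjesIntegral (f * g) E a b = stieltjesIntegral f E a b * stieltjesIntegral g E a b :=
  stieltjesIntegral_eq hab (((hE.tendsto_stieltjesSum hf hab).mul
    (hE.tendsto_stieltjesSum hg hab)).congr fun π => (hE.stieltjesSum_mul f g π).symm)

theorem norm_stieltjesIntegral_le (hE : IsProjectionFamily E) (hf : Continuous f) (hab : a ≤ b)
    {C : ℝ} (hC : 0 ≤ C) (hfC : ∀ ω ∈ Set.Icc a b, ‖f ω‖ ≤ C) : ‖stieltjesIntegral f E a b‖ ≤ C :=
  have := neBot_meshFilter hab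
  le_of_tendsto (hE.tendsto_stieltjesSum hf hab).norm
    (Eventually.of_forall (hE.norm_stieltjesSum_le hC hfC))

theorem commute_stieltjesIntegral (hE : IsProjectionFamily E) (hf : Continuous f) (hab : a ≤ b)
    {T : Y →L[ℂ] Y} (hT : ∀ ω, Commute T (E ω)) : Commute T (stieltjesIntegral f E a b) := by
  have := neBot_meshFilter hab
  have h := hE.tendsto_stieltjesSum hf hab
  exact tendsto_nhds_unique (h.const_mul T)
    ((h.mul_const T).congr fun π => (commute_stieltjesSum hT f π).eq.symm)

theorem commute_increment_stieltjesIntegral (hE : IsProjectionFamily E) (hf : Continuous f)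
    (hcd : c ≤ d) (a b : ℝ) : Commute (increment E a b) (stieltjesIntegral f E c d) :=
  hE.commute_stieltjesIntegral hf hcd fun ω => ((hE.commute ω b).sub_right (hE.commute ω a)).symm

theorem increment_mul_stieltjesIntegral (hE : IsProjectionFamily E) (hf : Continuous f)
    (hca : c ≤ a) (hab : a ≤ b) (hbd : b ≤ d) :
    increment E a b * stieltjesIntegral f E c d = stieltjesIntegral f E a b := by
  rw [(hE.commute_increment_stieltjesIntegral hf (hca.trans (hab.trans hbd)) a b).eq,
    hE.stieltjesIntegral_mul_increment hf hca hab hbd]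

theorem stieltjesIntegral_apply_increment (hE : IsProjectionFamily E) (hf : Continuous f)
    (hab : a ≤ b) (z : Y) :
    stieltjesIntegral f E a b (increment E a b z) = stieltjesIntegral f E a b z :=
  DFunLike.congr_fun (hE.stieltjesIntegral_mul_increment hf le_rfl hab le_rfl) z

theorem stieltjesIntegral_apply (hE : IsProjectionFamily E) (hf : Continuous f) (hab : a ≤ b)
    (z : Y) : stieltjesIntegral f (fun ω => E ω z) a b = stieltjesIntegral f E a b z :=
  stieltjesIntegral_eq hab
    ((((ContinuousLinearMap.apply ℂ Y z).continuous.tendsto _).comp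
      (hE.tendsto_stieltjesSum hf hab)).congr (map_stieltjesSum _))

theorem hasStieltjesIntegralOn_apply (hE : IsProjectionFamily E) (hf : Continuous f)
    (hab : a ≤ b) (z : Y) :
    HasStieltjesIntegralOn f (fun ω => E ω z) a b (stieltjesIntegral f E a b z) :=
  HasStieltjesIntegralOn.map
    (hasStieltjesIntegralOn_iff_tendsto.2 (hE.tendsto_stieltjesSum hf hab))
    (ContinuousLinearMap.apply ℂ Y z)

end IsProjectionFamily

end StieltjesProjection

/-- A projection family that increases from `0` to `1`, in the strong topology. -/
structure IsResolutionOfIdentity {Y : Type*} [NormedAddCommGroup Y] [InnerProductSpace ℂ Y]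
    [CompleteSpace Y] (E : ℝ → Y →L[ℂ] Y) : Prop extends IsProjectionFamily E where
  tendsto_atBot : ∀ z : Y, Tendsto (fun ω => E ω z) atBot (𝓝 0)
  tendsto_atTop : ∀ z : Y, Tendsto (fun ω => E ω z) atTop (𝓝 z)

namespace IsResolutionOfIdentity

variable {Y : Type*} [NormedAddCommGroup Y] [InnerProductSpace ℂ Y] [CompleteSpace Y]
  {E : ℝ → Y →L[ℂ] Y} {f : ℝ → ℂ} {a b : ℝ}

theorem tendsto_increment (hE : IsResolutionOfIdentity E) (z : Y) :
    Tendsto (fun p : ℝ × ℝ => increment E p.1 p.2 z) (atBot ×ˢ atTop) (𝓝 z) := by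
  have h := ((hE.tendsto_atTop z).comp (tendsto_snd (f := atBot (α := ℝ)))).sub
    ((hE.tendsto_atBot z).comp (tendsto_fst (g := atTop (α := ℝ))))
  rwa [sub_zero] at h

theorem ext_increment (hE : IsResolutionOfIdentity E) {y z : Y}
    (h : ∀ a b : ℝ, a ≤ b → increment E a b y = increment E a b z) : y = z := by
  refine tendsto_nhds_unique ((hE.tendsto_increment y).congr' ?_) (hE.tendsto_increment z)
  filter_upwards [eventually_fst_le_snd] with p hp
  exact h _ _ hp

theorem hasStieltjesIntegral_iff (hE : IsResolutionOfIdentity E) (hf : Continuous f) {y z : Y} :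
    HasStieltjesIntegral f (fun ω => E ω z) y ↔
      ∀ a b : ℝ, a ≤ b → increment E a b y = stieltjesIntegral f E a b z := by
  have hint (a b : ℝ) (hab : a ≤ b) := hE.stieltjesIntegral_apply hf hab z
  rw [hasStieltjesIntegral_iff_tendsto fun a b hab => by
    rw [hint a b hab]; exact hE.hasStieltjesIntegralOn_apply hf hab z]
  constructor
  · intro h a b hab
    refine tendsto_nhds_unique (((increment E a b).continuous.tendsto y).comp h)
      (tendsto_const_nhds.congr' ?_)
    filter_upwards [(eventually_le_atBot a).prod_mk (eventually_ge_atTop b)] with p hp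
    rw [Function.comp_apply, hint _ _ (hp.1.trans (hab.trans hp.2)),
      ← hE.increment_mul_stieltjesIntegral hf hp.1 hab hp.2]
    rfl
  · intro h
    refine (hE.tendsto_increment y).congr' ?_
    filter_upwards [eventually_fst_le_snd] with p hp
    rw [h _ _ hp, hint _ _ hp]

theorem norm_stieltjesIntegral_sub_le (hE : IsResolutionOfIdentity E) {c d C : ℝ}
    (hf : Continuous f) (hca : c ≤ a) (hab : a ≤ b) (hbd : b ≤ d) (hC : 0 ≤ C)
    (hfC : ∀ ω, ‖f ω‖ ≤ C) (z : Y) :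
    ‖stieltjesIntegral f E c d z - stieltjesIntegral f E a b z‖ ≤ C * ‖z - increment E a b z‖ := by
  rw [← hE.stieltjesIntegral_mul_increment hf hca hab hbd, mul_apply_eq_comp,
    ← map_sub]
  exact ContinuousLinearMap.le_of_opNorm_le _
    (hE.norm_stieltjesIntegral_le hf (hca.trans (hab.trans hbd)) hC fun ω _ => hfC ω) _

theorem norm_sub_increment_apply_le (hE : IsResolutionOfIdentity E) {C : ℝ} (hf : Continuous f)
    (hC : 0 ≤ C) (hfC : ∀ ω, ‖f ω‖ ≤ C) {y z : Y}
    (h : HasStieltjesIntegral f (fun ω => E ω z) y) (hab : a ≤ b) :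
    ‖y - increment E a b y‖ ≤ C * ‖z - increment E a b z‖ := by
  have hint := (hE.hasStieltjesIntegral_iff hf).1 h
  rw [hint a b hab]
  refine le_of_tendsto ((hE.tendsto_increment y).sub_const _).norm ?_
  filter_upwards [(eventually_le_atBot a).prod_mk (eventually_ge_atTop b)] with p hp
  rw [hint _ _ (hp.1.trans (hab.trans hp.2))]
  exact hE.norm_stieltjesIntegral_sub_le hf hp.1 hab hp.2 hC hfC z

theorem exists_hasStieltjesIntegral (hE : IsResolutionOfIdentity E) {C : ℝ} (hf : Continuous f)
    (hC : 0 ≤ C) (hfC : ∀ ω, ‖f ω‖ ≤ C) (z : Y) :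
    ∃ y, HasStieltjesIntegral f (fun ω => E ω z) y := by
  have hn : Tendsto (fun n : ℕ => (-(n : ℝ), (n : ℝ))) atTop (atBot ×ˢ atTop) :=
    (tendsto_neg_atTop_atBot.comp tendsto_natCast_atTop_atTop).prodMk tendsto_natCast_atTop_atTop
  have hcauchy : CauchySeq fun n : ℕ => stieltjesIntegral f E (-n) n z := by
    refine cauchySeq_of_le_tendsto_0' (fun n : ℕ => C * ‖z - increment E (-n) n z‖)
      (fun n m hnm => ?_) ?_
    · have hnm : (n : ℝ) ≤ m := Nat.cast_le.2 hnm
      rw [dist_comm, dist_eq_norm]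
      exact hE.norm_stieltjesIntegral_sub_le hf (neg_le_neg hnm)
        (neg_le_self n.cast_nonneg) hnm hC hfC z
    · simpa only [Function.comp_def, sub_self, norm_zero, mul_zero] using
        (((hE.tendsto_increment z).comp hn).const_sub z).norm.const_mul C
  obtain ⟨y, hy⟩ := cauchySeq_tendsto_of_complete hcauchy
  refine ⟨y, (hE.hasStieltjesIntegral_iff hf).2 fun a b hab => ?_⟩
  refine tendsto_nhds_unique (((increment E a b).continuous.tendsto y).comp hy)
    (tendsto_const_nhds.congr' ?_)
  filter_upwards [hn.eventually
    ((eventually_le_atBot a).prod_mk (eventually_ge_atTop b))] with n hn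
  rw [← hE.increment_mul_stieltjesIntegral hf hn.1 hab hn.2]
  rfl

end IsResolutionOfIdentity

theorem IsSpectralResolution.isResolutionOfIdentity {Y : Type*} [NormedAddCommGroup Y]
    [InnerProductSpace ℂ Y] [CompleteSpace Y] {H : Y →ₗ.[ℂ] Y} {E : ℝ → Y →L[ℂ] Y}
    (hE : IsSpectralResolution H E) : IsResolutionOfIdentity E where
  isStarProjection := hE.projection
  mul_of_le := hE.mono
  tendsto_atBot := hE.tendsto_atBot
  tendsto_atTop := hE.tendsto_atTop

/-- The symbol `ω ↦ e^{-iωt}` of the unitary group generated by a selfadjoint operator. -/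
def phase (t ω : ℝ) : ℂ := Complex.exp ((-(ω * t) : ℝ) * Complex.I)

theorem continuous_phase (t : ℝ) : Continuous (phase t) := by
  unfold phase
  fun_prop

theorem norm_phase (t ω : ℝ) : ‖phase t ω‖ = 1 := Complex.norm_exp_ofReal_mul_I _

theorem phase_zero : phase 0 = 1 := by
  ext ω
  simp [phase]

theorem phase_add (s t : ℝ) : phase (s + t) = phase s * phase t := by
  ext ω
  rw [Pi.mul_apply, phase, phase, phase, ← Complex.exp_add]
  congr 1
  push_cast
  ring

theorem norm_phase_sub_one_sub_le {t ω C : ℝ} (hω : |ω| ≤ C) (ht : C * |t| ≤ 1) :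
    ‖phase t ω - 1 - (-Complex.I * t) * ω‖ ≤ C ^ 2 * |t| ^ 2 := by
  have hx : ‖((-(ω * t) : ℝ) : ℂ) * Complex.I‖ ≤ C * |t| := by
    rw [norm_mul, Complex.norm_I, mul_one, Complex.norm_real, norm_neg, norm_mul]
    exact mul_le_mul_of_nonneg_right hω (abs_nonneg t)
  have h := Complex.norm_exp_sub_one_sub_id_le (hx.trans ht)
  rw [show (-Complex.I * t) * ω = ((-(ω * t) : ℝ) : ℂ) * Complex.I by push_cast; ring]
  exact h.trans ((pow_le_pow_left₀ (norm_nonneg _) hx 2).trans_eq (mul_pow _ _ _))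

section Evolution

variable {Y : Type*} [NormedAddCommGroup Y] [InnerProductSpace ℂ Y] [CompleteSpace Y]
  {E : ℝ → Y →L[ℂ] Y} {a b : ℝ}

theorem stieltjesIntegral_phase_zero (E : ℝ → Y →L[ℂ] Y) (hab : a ≤ b) :
    stieltjesIntegral (phase 0) E a b = increment E a b := by
  rw [phase_zero, stieltjesIntegral_one E hab]

namespace IsProjectionFamily

theorem stieltjesIntegral_phase_add (hE : IsProjectionFamily E) (hab : a ≤ b) (s t : ℝ) :
    stieltjesIntegral (phase (s + t)) E a b =
      stieltjesIntegral (phase s) E a b * stieltjesIntegral (phase t) E a b := by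
  rw [phase_add, hE.stieltjesIntegral_mul (continuous_phase s) (continuous_phase t) hab]

theorem norm_stieltjesIntegral_phase_le_one (hE : IsProjectionFamily E) (hab : a ≤ b) (t : ℝ) :
    ‖stieltjesIntegral (phase t) E a b‖ ≤ 1 :=
  hE.norm_stieltjesIntegral_le (continuous_phase t) hab zero_le_one fun ω _ => (norm_phase t ω).le

theorem norm_stieltjesIntegral_phase_sub_le (hE : IsProjectionFamily E) (hab : a ≤ b) {t : ℝ}
    (ht : max |a| |b| * |t| ≤ 1) :
    ‖stieltjesIntegral (phase t) E a b - increment E a b -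
      (-Complex.I * t) • stieltjesIntegral (fun ω : ℝ => (ω : ℂ)) E a b‖ ≤
        max |a| |b| ^ 2 * |t| ^ 2 := by
  have hid : Continuous fun ω : ℝ => (ω : ℂ) := Complex.continuous_ofReal
  rw [← stieltjesIntegral_one E hab, ← hE.stieltjesIntegral_smul _ hid hab,
    ← hE.stieltjesIntegral_sub (continuous_phase t) continuous_one hab,
    ← hE.stieltjesIntegral_sub ((continuous_phase t).sub continuous_one) (hid.const_smul _) hab]
  exact hE.norm_stieltjesIntegral_le (((continuous_phase t).sub continuous_one).sub
    (hid.const_smul _)) hab (by positivity) fun ω hω =>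
      norm_phase_sub_one_sub_le (abs_le_max_abs_abs hω.1 hω.2) ht

theorem hasDerivAt_stieltjesIntegral_phase (hE : IsProjectionFamily E) (hab : a ≤ b) (t : ℝ) :
    HasDerivAt (fun s => stieltjesIntegral (phase s) E a b)
      (-Complex.I • (stieltjesIntegral (fun ω : ℝ => (ω : ℂ)) E a b *
        stieltjesIntegral (phase t) E a b)) t := by
  set A := stieltjesIntegral (fun ω : ℝ => (ω : ℂ)) E a b
  have hzero :
      HasDerivAt (fun s => stieltjesIntegral (phase s) E a b) (-Complex.I • A) (t - t) := by
    rw [sub_self, hasDerivAt_iff_isLittleO_nhds_zero]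
    refine (Asymptotics.IsBigO.of_bound (max |a| |b| ^ 2) ?_).trans_isLittleO
      (Asymptotics.isLittleO_pow_id one_lt_two)
    have hsmall : ∀ᶠ s : ℝ in 𝓝 0, max |a| |b| * |s| < 1 :=
      (continuous_const.mul continuous_abs).tendsto' 0 0 (by simp) |>.eventually_lt_const one_pos
    filter_upwards [hsmall] with s hs
    have h := hE.norm_stieltjesIntegral_phase_sub_le hab hs.le
    rwa [zero_add, stieltjesIntegral_phase_zero E hab, norm_pow, Real.norm_eq_abs,
      ← Complex.coe_smul, smul_smul, mul_comm (s : ℂ)]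
  have h := (hzero.comp_sub_const t t).mul_const (stieltjesIntegral (phase t) E a b)
  rw [smul_mul_assoc] at h
  refine h.congr_of_eventuallyEq (Eventually.of_forall fun s => ?_)
  simp only
  rw [← hE.stieltjesIntegral_phase_add hab, sub_add_cancel]

theorem hasDerivAt_stieltjesIntegral_phase_apply (hE : IsProjectionFamily E) (hab : a ≤ b) (z : Y)
    (t : ℝ) : HasDerivAt (fun s => stieltjesIntegral (phase s) E a b z)
      (((-Complex.I) • stieltjesIntegral (fun ω : ℝ => (ω : ℂ)) E a b)
        (stieltjesIntegral (phase t) E a b z)) t :=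
  ((ContinuousLinearMap.apply ℂ Y z).restrictScalars ℝ).hasFDerivAt.comp_hasDerivAt t
    (hE.hasDerivAt_stieltjesIntegral_phase hab t)

end IsProjectionFamily

theorem IsResolutionOfIdentity.continuous_of_hasStieltjesIntegral_phase
    (hE : IsResolutionOfIdentity E) {q : ℝ → Y} {x : Y}
    (hq : ∀ t, HasStieltjesIntegral (phase t) (fun ω => E ω x) (q t)) : Continuous q := by
  have hunif : TendstoUniformly (fun (p : ℝ × ℝ) t => increment E p.1 p.2 (q t)) q
      (atBot ×ˢ atTop) := by
    have hx : Tendsto (fun p : ℝ × ℝ => ‖x - increment E p.1 p.2 x‖) (atBot ×ˢ atTop) (𝓝 0) := by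
      simpa only [sub_self, norm_zero] using ((hE.tendsto_increment x).const_sub x).norm
    refine Metric.tendstoUniformly_iff.2 fun ε hε => ?_
    filter_upwards [hx.eventually_lt_const hε, eventually_fst_le_snd] with p hpε hp t
    rw [dist_eq_norm]
    refine (hE.norm_sub_increment_apply_le (continuous_phase t) zero_le_one
      (fun ω => (norm_phase t ω).le) (hq t) hp).trans_lt ?_
    rwa [one_mul]
  refine hunif.continuous (Eventually.frequently ?_)
  filter_upwards [eventually_fst_le_snd] with p hp
  simp only [fun t => (hE.hasStieltjesIntegral_iff (continuous_phase t)).1 (hq t) _ _ hp]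
  exact continuous_iff_continuousAt.2 fun t =>
    (hE.hasDerivAt_stieltjesIntegral_phase_apply hp x t).continuousAt

/-- `q` is a mild solution of `i q' = H q`. -/
structure IsEvolution (H : Y →ₗ.[ℂ] Y) (q : ℝ → Y) : Prop where
  continuous : Continuous q
  integral_mem_graph : ∀ t : ℝ, (∫ s in (0 : ℝ)..t, q s, Complex.I • (q t - q 0)) ∈ H.graph

namespace IsSpectralResolution

variable {H : Y →ₗ.[ℂ] Y} {q : ℝ → Y}

theorem mem_graph_iff (hE : IsSpectralResolution H E) {z w : Y} : (z, w) ∈ H.graph ↔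
    ∀ a b : ℝ, a ≤ b →
      increment E a b w = stieltjesIntegral (fun ω : ℝ => (ω : ℂ)) E a b z :=
  (hE.integral z w).trans
    (hE.isResolutionOfIdentity.hasStieltjesIntegral_iff Complex.continuous_ofReal)

theorem hasDerivAt_increment_apply_evolution (hE : IsSpectralResolution H E)
    (hq : IsEvolution H q) (hab : a ≤ b) (t : ℝ) :
    HasDerivAt (fun s => increment E a b (q s)) (((-Complex.I) •
      stieltjesIntegral (fun ω : ℝ => (ω : ℂ)) E a b) (increment E a b (q t))) t := by
  set A := stieltjesIntegral (fun ω : ℝ => (ω : ℂ)) E a b with hA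
  have hmild (s : ℝ) : increment E a b (q s) =
      increment E a b (q 0) + ((-Complex.I) • A) (∫ r in (0 : ℝ)..s, q r) := by
    rw [smul_apply, hA,
      ← hE.mem_graph_iff.1 (hq.integral_mem_graph s) a b hab, map_smul, map_sub, smul_smul]
    simp
  have hint : HasDerivAt (fun s => ∫ r in (0 : ℝ)..s, q r) (q t) t :=
    intervalIntegral.integral_hasDerivAt_right (hq.continuous.intervalIntegrable 0 t)
      hq.continuous.stronglyMeasurable.stronglyMeasurableAtFilter hq.continuous.continuousAt
  have hAP : A (increment E a b (q t)) = A (q t) :=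
    hE.isResolutionOfIdentity.stieltjesIntegral_apply_increment Complex.continuous_ofReal hab _
  rw [smul_apply, hAP]
  exact ((((-Complex.I) • A).restrictScalars ℝ).hasFDerivAt.comp_hasDerivAt t hint).const_add _
    |>.congr_of_eventuallyEq (Eventually.of_forall hmild)

theorem increment_apply_evolution (hE : IsSpectralResolution H E) (hq : IsEvolution H q)
    (hab : a ≤ b) (t : ℝ) :
    increment E a b (q t) = stieltjesIntegral (phase t) E a b (q 0) := by
  set A := stieltjesIntegral (fun ω : ℝ => (ω : ℂ)) E a b
  refine congrFun (f := fun s => increment E a b (q s)) (ODE_solution_unique_univ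
    (v := fun _ => (-Complex.I) • A) (s := fun _ => Set.univ) (t₀ := 0)
    (fun _ => ((-Complex.I) • A).lipschitz.lipschitzOnWith)
    (fun s => ⟨hE.hasDerivAt_increment_apply_evolution hq hab s, trivial⟩)
    (fun s => ⟨hE.isResolutionOfIdentity.hasDerivAt_stieltjesIntegral_phase_apply hab (q 0) s,
      trivial⟩) ?_) t
  rw [stieltjesIntegral_phase_zero E hab]

theorem hasStieltjesIntegral_phase (hE : IsSpectralResolution H E) (hq : IsEvolution H q) (t : ℝ) :
    HasStieltjesIntegral (phase t) (fun ω => E ω (q 0)) (q t) :=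
  (hE.isResolutionOfIdentity.hasStieltjesIntegral_iff (continuous_phase t)).2
    fun _ _ hab => hE.increment_apply_evolution hq hab t

theorem evolution_unique (hE : IsSpectralResolution H E) {q' : ℝ → Y} (hq : IsEvolution H q)
    (hq' : IsEvolution H q') (h : q 0 = q' 0) : q = q' :=
  funext fun t => hE.isResolutionOfIdentity.ext_increment fun a b hab => by
    rw [hE.increment_apply_evolution hq hab, hE.increment_apply_evolution hq' hab, h]

theorem norm_increment_apply_evolution (hE : IsSpectralResolution H E) (hq : IsEvolution H q)
    (hab : a ≤ b) (t : ℝ) : ‖increment E a b (q t)‖ = ‖increment E a b (q 0)‖ := by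
  have hfam := hE.isResolutionOfIdentity.toIsProjectionFamily
  have hle (s : ℝ) (z : Y) : ‖stieltjesIntegral (phase s) E a b z‖ ≤ ‖z‖ :=
    (ContinuousLinearMap.le_of_opNorm_le _ (hfam.norm_stieltjesIntegral_phase_le_one hab s)
      z).trans_eq (one_mul _)
  have hback : stieltjesIntegral (phase (-t)) E a b (increment E a b (q t)) =
      increment E a b (q 0) := by
    rw [hE.increment_apply_evolution hq hab, ← mul_apply_eq_comp,
      ← hfam.stieltjesIntegral_phase_add hab, neg_add_cancel, stieltjesIntegral_phase_zero E hab]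
  have hforth : stieltjesIntegral (phase t) E a b (increment E a b (q 0)) =
      increment E a b (q t) := by
    rw [hfam.stieltjesIntegral_apply_increment (continuous_phase t) hab,
      hE.increment_apply_evolution hq hab]
  refine le_antisymm ?_ ?_
  · exact hforth ▸ hle t _
  · exact hback ▸ hle (-t) _

theorem norm_evolution (hE : IsSpectralResolution H E) (hq : IsEvolution H q) (t : ℝ) :
    ‖q t‖ = ‖q 0‖ := by
  have hlim (s : ℝ) := (hE.isResolutionOfIdentity.tendsto_increment (q s)).norm
  refine tendsto_nhds_unique (hlim t) ((hlim 0).congr' ?_)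
  filter_upwards [eventually_fst_le_snd] with p hp
  exact (hE.norm_increment_apply_evolution hq hp t).symm

theorem exists_evolution (hE : IsSpectralResolution H E) (x : Y) :
    ∃ q, IsEvolution H q ∧ q 0 = x := by
  have hres := hE.isResolutionOfIdentity
  choose q hq using fun t => hres.exists_hasStieltjesIntegral (continuous_phase t) zero_le_one
    (fun ω => (norm_phase t ω).le) x
  have hcont : Continuous q := hres.continuous_of_hasStieltjesIntegral_phase hq
  have hPq {a b : ℝ} (hab : a ≤ b) (t : ℝ) :
      increment E a b (q t) = stieltjesIntegral (phase t) E a b x :=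
    (hres.hasStieltjesIntegral_iff (continuous_phase t)).1 (hq t) a b hab
  refine ⟨q, ⟨hcont, fun t => hE.mem_graph_iff.2 fun a b hab => ?_⟩, ?_⟩
  · set A := stieltjesIntegral (fun ω : ℝ => (ω : ℂ)) E a b with hA
    have hderiv (s : ℝ) : HasDerivAt (fun s => increment E a b (q s))
        (((-Complex.I) • A) (q s)) s := by
      have hAq : A (q s) = A (stieltjesIntegral (phase s) E a b x) := by
        rw [← hPq hab, hA, hres.stieltjesIntegral_apply_increment Complex.continuous_ofReal hab]
      simp only [hPq hab, smul_apply, hAq]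
      exact hres.hasDerivAt_stieltjesIntegral_phase_apply hab x s
    have hint := intervalIntegral.integral_eq_sub_of_hasDerivAt (fun s _ => hderiv s)
      ((((-Complex.I) • A).continuous.comp hcont).intervalIntegrable 0 t)
    rw [ContinuousLinearMap.intervalIntegral_comp_comm _ (hcont.intervalIntegrable 0 t)] at hint
    rw [map_smul, map_sub, ← hint, smul_apply, smul_smul]
    simp
  · exact hres.ext_increment fun a b hab => by rw [hPq hab, stieltjesIntegral_phase_zero E hab]

end IsSpectralResolution

end Evolution

section InvariantSubspace

variable {𝕜 Y : Type*} [RCLike 𝕜] [NormedAddCommGroup Y] [InnerProductSpace 𝕜 Y] [CompleteSpace Y]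

theorem tendsto_starProjection_iInf {ι : Type*} [Preorder ι]
    (N : ι → Submodule 𝕜 Y) [∀ i, (N i).HasOrthogonalProjection]
    [(⨅ i, N i).HasOrthogonalProjection] (hN : Antitone N) (z : Y) :
    Tendsto (fun i => (N i).starProjection z) atTop (𝓝 ((⨅ i, N i).starProjection z)) := by
  have hsub (U : Submodule 𝕜 Y) [U.HasOrthogonalProjection] :
      z - Uᗮ.starProjection z = U.starProjection z := by
    rw [Submodule.starProjection_orthogonal_val, sub_sub_cancel]
  have hclosure : (⨆ i, (N i)ᗮ).topologicalClosure = (⨅ i, N i)ᗮ := by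
    rw [← Submodule.orthogonal_orthogonal_eq_closure, ← Submodule.iInf_orthogonal]
    simp only [Submodule.orthogonal_orthogonal]
  have h := (Submodule.starProjection_tendsto_closure_iSup (fun i => (N i)ᗮ)
    (fun i j hij => Submodule.orthogonal_le (hN hij)) z).const_sub z
  simpa only [hclosure, hsub] using h

theorem commute_starProjection {K : Y →L[𝕜] Y} (hK : IsSelfAdjoint K) {U : Submodule 𝕜 Y}
    [U.HasOrthogonalProjection] (hU : ∀ x ∈ U, K x ∈ U) : Commute K U.starProjection := by
  refine ((ContinuousLinearMap.IsIdempotentElem.commute_iff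
    (isStarProjection_starProjection (U := U)).isIdempotentElem).2 ⟨?_, ?_⟩).symm
  · rw [Submodule.range_starProjection]
    exact hU
  · rw [Submodule.ker_starProjection]
    refine ContinuousLinearMap.orthogonal_mem_invtSubmodule ?_
    rwa [← ContinuousLinearMap.star_eq_adjoint, hK.star_eq]

end InvariantSubspace

theorem eq_zero_of_forall_norm_smul_apply_apply_le {𝕜 Y : Type*} [NormedField 𝕜]
    [NormedAddCommGroup Y] [NormedSpace ℝ Y] [NormedSpace 𝕜 Y] {K : Y →L[𝕜] Y}
    (hinj : Function.Injective K) {x : Y} (h : ∀ m : ℕ, ‖(m : ℝ) • K (K x)‖ ≤ ‖K x‖) : x = 0 := by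
  have hKK : K (K x) = 0 := by
    by_contra hne
    obtain ⟨m, hm⟩ := exists_nat_gt (‖K x‖ / ‖K (K x)‖)
    rw [div_lt_iff₀ (norm_pos_iff.2 hne)] at hm
    refine hm.not_ge (le_of_eq_of_le ?_ (h m))
    rw [norm_smul, Real.norm_natCast]
  exact (map_eq_zero_iff K hinj).1 ((map_eq_zero_iff K hinj).1 hKK)

section Calculus

variable {Y : Type*} [NormedAddCommGroup Y] [InnerProductSpace ℂ Y] [CompleteSpace Y]
  {K : Y →L[ℂ] Y}

theorem norm_cfc_apply_le (K : Y →L[ℂ] Y) {g h : ℝ → ℝ} (hg : Continuous g) (hh : Continuous h)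
    (hgh : ∀ k, |g k| ≤ |h k|) (x : Y) : ‖cfc g K x‖ ≤ ‖cfc h K x‖ := by
  have hsq {f : ℝ → ℝ} (hf : Continuous f) :
      (inner ℂ (cfc (fun k => f k * f k) K x) x).re = ‖cfc f K x‖ ^ 2 := by
    have hsymm := (cfc_predicate f K : IsSelfAdjoint (cfc f K)).isSymmetric (cfc f K x) x
    rw [cfc_mul f f K hf.continuousOn hf.continuousOn, mul_apply_eq_comp]
    exact (congrArg Complex.re hsymm).trans (inner_self_eq_norm_sq (𝕜 := ℂ) _)
  have hle : cfc (fun k => g k * g k) K ≤ cfc (fun k => h k * h k) K :=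
    cfc_mono (fun k _ => abs_le_iff_mul_self_le.1 (hgh k)) (hg.mul hg).continuousOn
      (hh.mul hh).continuousOn
  have hpos := ((ContinuousLinearMap.le_def _ _).1 hle).2 x
  rw [ContinuousLinearMap.reApplyInnerSelf_apply, sub_apply, inner_sub_left, map_sub] at hpos
  refine le_of_sq_le_sq ?_ (norm_nonneg _)
  rw [← hsq hg, ← hsq hh]
  exact sub_nonneg.1 hpos

theorem norm_cfc_apply_le_of_apply_eq_zero {g h u : ℝ → ℝ} (hg : Continuous g)
    (hh : Continuous h) (hu : Continuous u) (hgh : ∀ k, |g k| ≤ |u k + h k|) {x : Y}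
    (hx : cfc u K x = 0) : ‖cfc g K x‖ ≤ ‖cfc h K x‖ := by
  refine (norm_cfc_apply_le K hg (hu.add hh) hgh x).trans_eq ?_
  rw [Pi.add_def, cfc_add K u h hu.continuousOn hh.continuousOn, add_apply, hx, zero_add]

theorem cfc_linear_add_quadratic_apply (hK : IsSelfAdjoint K) (c d : ℝ) (x : Y) :
    cfc (fun k : ℝ => c * k + d * k ^ 2) K x = c • K x + d • K (K x) := by
  rw [cfc_add K (fun k => c * k) (fun k => d * k ^ 2), cfc_const_mul c (fun k : ℝ => k) K,
    cfc_const_mul d (fun k : ℝ => k ^ 2) K, cfc_id' ℝ K, cfc_pow_id K 2, sq]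
  rfl

theorem norm_linear_add_quadratic_apply_le (hK : IsSelfAdjoint K) {c d c' d' : ℝ} {u : ℝ → ℝ}
    (hu : Continuous u) (h : ∀ k, |c * k + d * k ^ 2| ≤ |u k + (c' * k + d' * k ^ 2)|) {x : Y}
    (hx : cfc u K x = 0) : ‖c • K x + d • K (K x)‖ ≤ ‖c' • K x + d' • K (K x)‖ := by
  simp only [← cfc_linear_add_quadratic_apply hK]
  exact norm_cfc_apply_le_of_apply_eq_zero (by fun_prop) (by fun_prop) hu h hx

/-- The function `k ↦ k - ω k²`. At an eigenvalue `k ≠ 0` of an operator it is positive or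
negative according as the eigenvalue `k⁻¹` of the inverse operator is greater or less than `ω`. -/
def inverseSymbol (ω k : ℝ) : ℝ := k - ω * k ^ 2

theorem continuous_posPart_inverseSymbol (ω : ℝ) : Continuous fun k => (inverseSymbol ω k)⁺ := by
  unfold inverseSymbol
  exact continuous_posPart.comp (by fun_prop)

theorem continuous_negPart_inverseSymbol (ω : ℝ) : Continuous fun k => (inverseSymbol ω k)⁻ := by
  unfold inverseSymbol
  exact continuous_negPart.comp (by fun_prop)

/-- The spectral subspace of `K⁻¹` that belongs to `(-∞, ω]`. -/
def inverseSpectralSubspace (K : Y →L[ℂ] Y) (ω : ℝ) : Submodule ℂ Y :=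
  (cfc (fun k => (inverseSymbol ω k)⁺) K).ker

theorem mem_inverseSpectralSubspace {ω : ℝ} {x : Y} :
    x ∈ inverseSpectralSubspace K ω ↔ cfc (fun k => (inverseSymbol ω k)⁺) K x = 0 :=
  LinearMap.mem_ker

instance (ω : ℝ) : (inverseSpectralSubspace K ω).HasOrthogonalProjection :=
  have : CompleteSpace (inverseSpectralSubspace K ω) :=
    (ContinuousLinearMap.isClosed_ker _).completeSpace_coe
  inferInstance

theorem monotone_inverseSpectralSubspace : Monotone (inverseSpectralSubspace K) := by
  intro a b hab x hx
  rw [mem_inverseSpectralSubspace] at hx ⊢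
  rw [← norm_le_zero_iff, ← norm_eq_zero.2 hx]
  refine norm_cfc_apply_le K (continuous_posPart_inverseSymbol b)
    (continuous_posPart_inverseSymbol a) (fun k => ?_) x
  rw [abs_of_nonneg (posPart_nonneg _), abs_of_nonneg (posPart_nonneg _)]
  exact posPart_mono (sub_le_sub_left (mul_le_mul_of_nonneg_right hab (sq_nonneg k)) k)

theorem cfc_negPart_apply_eq_zero {ω : ℝ} {x : Y} (hx : x ∈ (inverseSpectralSubspace K ω)ᗮ) :
    cfc (fun k => (inverseSymbol ω k)⁻) K x = 0 := by
  refine ext_inner_left ℂ fun y => ?_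
  have hsymm := (cfc_predicate (fun k => (inverseSymbol ω k)⁻) K :
    IsSelfAdjoint (cfc (fun k => (inverseSymbol ω k)⁻) K)).isSymmetric y x
  rw [inner_zero_right]
  refine hsymm.symm.trans
    ((Submodule.mem_orthogonal _ _).1 hx _ (mem_inverseSpectralSubspace.2 ?_))
  change (cfc (fun k => (inverseSymbol ω k)⁺) K * cfc (fun k => (inverseSymbol ω k)⁻) K) y = 0
  rw [← cfc_mul _ _ K (continuous_posPart_inverseSymbol ω).continuousOn
    (continuous_negPart_inverseSymbol ω).continuousOn]
  have hzero (k : ℝ) : (inverseSymbol ω k)⁺ * (inverseSymbol ω k)⁻ = 0 := by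
    rcases le_total (inverseSymbol ω k) 0 with h | h
    · rw [posPart_eq_zero.2 h, zero_mul]
    · rw [negPart_eq_zero.2 h, mul_zero]
  simp only [hzero, cfc_const_zero, zero_apply]

theorem norm_apply_sub_smul_apply_apply_le (hK : IsSelfAdjoint K) {a b ξ : ℝ} (ha : a ≤ ξ)
    (hb : ξ ≤ b) {v : Y} (hvb : v ∈ inverseSpectralSubspace K b)
    (hva : v ∈ (inverseSpectralSubspace K a)ᗮ) :
    ‖K v - ξ • K (K v)‖ ≤ (b - a) * ‖K (K v)‖ := by
  have hupper := continuous_posPart_inverseSymbol b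
  have hlower := continuous_negPart_inverseSymbol a
  have h := norm_linear_add_quadratic_apply_le hK (c := 1) (d := -ξ) (c' := 0) (d' := b - a)
    (u := fun k => (inverseSymbol b k)⁺ + (inverseSymbol a k)⁻) (hupper.add hlower) (fun k => ?_)
    (x := v) ?_
  · rwa [one_smul, neg_smul, ← sub_eq_add_neg, zero_smul, zero_add, norm_smul,
      Real.norm_of_nonneg (sub_nonneg.2 (ha.trans hb))] at h
  · have hk : inverseSymbol b k ≤ (inverseSymbol b k)⁺ := le_posPart _
    have hk' : -inverseSymbol a k ≤ (inverseSymbol a k)⁻ := neg_le_negPart _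
    have hb : ξ * k ^ 2 ≤ b * k ^ 2 := mul_le_mul_of_nonneg_right hb (sq_nonneg k)
    have ha : a * k ^ 2 ≤ ξ * k ^ 2 := mul_le_mul_of_nonneg_right ha (sq_nonneg k)
    unfold inverseSymbol at hk hk' ⊢
    refine le_trans (abs_le.2 ⟨?_, ?_⟩) (le_abs_self _) <;>
      linarith [posPart_nonneg (k - b * k ^ 2), negPart_nonneg (k - a * k ^ 2)]
  · rw [cfc_add K _ _ hupper.continuousOn hlower.continuousOn, add_apply,
      mem_inverseSpectralSubspace.1 hvb, cfc_negPart_apply_eq_zero hva, zero_add]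

theorem iInf_inverseSpectralSubspace (hK : IsSelfAdjoint K) (hinj : Function.Injective K) :
    ⨅ ω, inverseSpectralSubspace K ω = ⊥ := by
  refine (Submodule.eq_bot_iff _).2 fun x hx =>
    eq_zero_of_forall_norm_smul_apply_apply_le hinj fun m => ?_
  have h := norm_linear_add_quadratic_apply_le hK (c := 0) (d := m) (c' := -1) (d' := 0)
    (continuous_posPart_inverseSymbol (-m)) (fun k => ?_)
    (mem_inverseSpectralSubspace.1 ((Submodule.mem_iInf _).1 hx (-m)))
  · simpa using h
  · have hk : inverseSymbol (-m) k ≤ (inverseSymbol (-m) k)⁺ := le_posPart _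
    unfold inverseSymbol at hk ⊢
    exact abs_le_abs_of_nonneg (by rw [zero_mul, zero_add]; positivity) (by linarith)

theorem iInf_orthogonal_inverseSpectralSubspace (hK : IsSelfAdjoint K)
    (hinj : Function.Injective K) : ⨅ ω, (inverseSpectralSubspace K ω)ᗮ = ⊥ := by
  refine (Submodule.eq_bot_iff _).2 fun x hx =>
    eq_zero_of_forall_norm_smul_apply_apply_le hinj fun m => ?_
  have h := norm_linear_add_quadratic_apply_le hK (c := 0) (d := m) (c' := 1) (d' := 0)
    (continuous_negPart_inverseSymbol m) (fun k => ?_)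
    (cfc_negPart_apply_eq_zero ((Submodule.mem_iInf _).1 hx m))
  · simpa using h
  · have hk : -inverseSymbol m k ≤ (inverseSymbol m k)⁻ := neg_le_negPart _
    unfold inverseSymbol at hk ⊢
    exact abs_le_abs_of_nonneg (by rw [zero_mul, zero_add]; positivity) (by linarith)

theorem iInf_inverseSpectralSubspace_Ioi (hK : IsSelfAdjoint K) (ω : ℝ) :
    ⨅ μ : Set.Ioi ω, inverseSpectralSubspace K μ = inverseSpectralSubspace K ω := by
  refine le_antisymm (fun x hx => ?_)
    (le_iInf fun μ => monotone_inverseSpectralSubspace (le_of_lt μ.2))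
  have hle (δ : ℝ) (hδ : 0 < δ) :
      ‖cfc (fun k => (inverseSymbol ω k)⁺) K x‖ ≤ δ * ‖K (K x)‖ := by
    have h := norm_cfc_apply_le_of_apply_eq_zero (K := K) (x := x)
      (g := fun k => (inverseSymbol ω k)⁺) (h := fun k => 0 * k + δ * k ^ 2)
      (continuous_posPart_inverseSymbol ω) (by fun_prop)
      (continuous_posPart_inverseSymbol (ω + δ)) (fun k => ?_)
      (mem_inverseSpectralSubspace.1
        ((Submodule.mem_iInf _).1 hx ⟨ω + δ, lt_add_of_pos_right ω hδ⟩))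
    · rwa [cfc_linear_add_quadratic_apply hK, zero_smul, zero_add, norm_smul,
        Real.norm_of_nonneg hδ.le] at h
    · have hk : inverseSymbol (ω + δ) k ≤ (inverseSymbol (ω + δ) k)⁺ := le_posPart _
      refine abs_le_abs_of_nonneg (posPart_nonneg _) (sup_le ?_ ?_)
      · unfold inverseSymbol at hk ⊢
        linarith
      · rw [zero_mul, zero_add]
        positivity
  have hlim : Tendsto (fun δ : ℝ => δ * ‖K (K x)‖) (𝓝[>] 0) (𝓝 0) :=
    tendsto_nhdsWithin_of_tendsto_nhds ((continuous_mul_const _).tendsto' _ _ (zero_mul _))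
  exact mem_inverseSpectralSubspace.2
    (norm_le_zero_iff.1 (ge_of_tendsto hlim (eventually_mem_nhdsWithin.mono hle)))

end Calculus

section InverseSpectralProjection

variable {Y : Type*} [NormedAddCommGroup Y] [InnerProductSpace ℂ Y] [CompleteSpace Y]
  {K : Y →L[ℂ] Y} {a b : ℝ}

/-- The spectral projection of `K⁻¹` that belongs to `(-∞, ω]`. -/
def inverseSpectralProjection (K : Y →L[ℂ] Y) (ω : ℝ) : Y →L[ℂ] Y :=
  (inverseSpectralSubspace K ω).starProjection

theorem isProjectionFamily_inverseSpectralProjection (K : Y →L[ℂ] Y) :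
    IsProjectionFamily (inverseSpectralProjection K) where
  isStarProjection _ := isStarProjection_starProjection
  mul_of_le _ _ h :=
    Submodule.starProjection_comp_starProjection_of_le (monotone_inverseSpectralSubspace h)

theorem commute_inverseSpectralProjection (hK : IsSelfAdjoint K) (ω : ℝ) :
    Commute K (inverseSpectralProjection K ω) := by
  refine commute_starProjection hK fun x hx => ?_
  have hcomm : Commute (cfc (fun k => (inverseSymbol ω k)⁺) K) K := by
    simpa only [cfc_id' ℝ K] using cfc_commute_cfc (fun k => (inverseSymbol ω k)⁺) (fun k => k) K
  rw [mem_inverseSpectralSubspace] at hx ⊢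
  rw [← mul_apply_eq_comp, hcomm.eq, mul_apply_eq_comp, hx, map_zero]

theorem tendsto_inverseSpectralProjection_nhdsGT (hK : IsSelfAdjoint K) (ω : ℝ) (z : Y) :
    Tendsto (fun μ => inverseSpectralProjection K μ z) (𝓝[>] ω)
      (𝓝 (inverseSpectralProjection K ω z)) := by
  let N (μ : (Set.Ioi ω)ᵒᵈ) : Submodule ℂ Y := inverseSpectralSubspace K (OrderDual.ofDual μ).1
  have hN : ⨅ μ, N μ = inverseSpectralSubspace K ω := iInf_inverseSpectralSubspace_Ioi hK ω
  have : (⨅ μ, N μ).HasOrthogonalProjection := hN ▸ inferInstance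
  have h := tendsto_starProjection_iInf N (fun _ _ h => monotone_inverseSpectralSubspace h) z
  simp only [hN] at h
  rw [← map_coe_Ioi_atBot ω, tendsto_map'_iff]
  exact h

theorem isResolutionOfIdentity_inverseSpectralProjection (hK : IsSelfAdjoint K)
    (hinj : Function.Injective K) : IsResolutionOfIdentity (inverseSpectralProjection K) where
  toIsProjectionFamily := isProjectionFamily_inverseSpectralProjection K
  tendsto_atBot z := by
    let N (μ : ℝᵒᵈ) : Submodule ℂ Y := inverseSpectralSubspace K (OrderDual.ofDual μ)
    have hN : ⨅ μ, N μ = ⊥ := iInf_inverseSpectralSubspace hK hinj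
    have : (⨅ μ, N μ).HasOrthogonalProjection := hN ▸ inferInstance
    have h := tendsto_starProjection_iInf N (fun _ _ h => monotone_inverseSpectralSubspace h) z
    simp only [hN, Submodule.starProjection_bot, zero_apply] at h
    exact h
  tendsto_atTop z := by
    refine Submodule.starProjection_tendsto_self _ monotone_inverseSpectralSubspace z ?_
    rw [← Submodule.orthogonal_orthogonal_eq_closure, ← Submodule.iInf_orthogonal,
      iInf_orthogonal_inverseSpectralSubspace hK hinj, Submodule.bot_orthogonal_eq_top]

theorem norm_apply_increment_sub_le (hK : IsSelfAdjoint K) {ξ : ℝ} (ha : a ≤ ξ) (hb : ξ ≤ b)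
    (z : Y) :
    ‖K (increment (inverseSpectralProjection K) a b z) -
        ξ • K (K (increment (inverseSpectralProjection K) a b z))‖ ≤
      (b - a) * ‖K (K (increment (inverseSpectralProjection K) a b z))‖ := by
  have hE := isProjectionFamily_inverseSpectralProjection K
  have hmono := monotone_inverseSpectralSubspace (K := K) (ha.trans hb)
  refine norm_apply_sub_smul_apply_apply_le hK ha hb (Submodule.sub_mem _
    (Submodule.starProjection_apply_mem _ z) (hmono (Submodule.starProjection_apply_mem _ z))) ?_
  rw [← Submodule.starProjection_apply_eq_zero_iff]
  change (inverseSpectralProjection K a * increment (inverseSpectralProjection K) a b) z = 0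
  rw [increment, mul_sub, hE.mul_of_le (ha.trans hb),
    (hE.isStarProjection a).isIdempotentElem.eq, sub_self, zero_apply]

theorem norm_apply_increment_sub_stieltjesSum_le (hK : IsSelfAdjoint K) {δ : ℝ} (hδ : 0 ≤ δ)
    (π : TaggedPartition a b) (hπ : ∀ i < π.size, π.point (i + 1) - π.point i < δ) (z : Y) :
    ‖K (increment (inverseSpectralProjection K) a b z) -
        K (K (stieltjesSum (fun ω : ℝ => (ω : ℂ)) (inverseSpectralProjection K) π z))‖ ≤
      δ * ‖K (K (increment (inverseSpectralProjection K) a b z))‖ := by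
  have hE := isProjectionFamily_inverseSpectralProjection K
  set P := fun i => increment (inverseSpectralProjection K) (π.point i) (π.point (i + 1))
  have hKP (i : ℕ) : Commute K (P i) :=
    (commute_inverseSpectralProjection hK _).sub_right (commute_inverseSpectralProjection hK _)
  have horth {i j : ℕ} (hi : i ∈ Finset.range π.size) (hj : j ∈ Finset.range π.size)
      (hij : i ≠ j) (x y : Y) : inner ℂ (P i x) (P j y) = 0 := by
    rw [Finset.mem_range] at hi hj
    exact inner_apply_apply_eq_zero
      (hE.isStarProjection_increment (π.point_le_point i.le_succ hi))
      (hE.increment_point_mul_increment_point π hi hj hij) x y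
  have hcomm (i : ℕ) (x : Y) : K (P i x) = P i (K x) := DFunLike.congr_fun (hKP i).eq x
  have hsum : increment (inverseSpectralProjection K) a b z = ∑ i ∈ Finset.range π.size, P i z := by
    rw [← sum_increment _ π, sum_apply]
  have hterm (i : ℕ) : K (P i z) - K (K ((π.tag i : ℂ) • P i z)) =
      P i (K z - K (K ((π.tag i : ℂ) • z))) := by
    simp only [map_smul, map_sub, hcomm]
  have hstieltjes : stieltjesSum (fun ω : ℝ => (ω : ℂ)) (inverseSpectralProjection K) π z =
      ∑ i ∈ Finset.range π.size, (π.tag i : ℂ) • P i z := by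
    rw [stieltjesSum, sum_apply]
    rfl
  rw [hsum, hstieltjes]
  simp only [map_sum, ← Finset.sum_sub_distrib, hterm]
  refine norm_sum_le_of_orthogonal (𝕜 := ℂ) hδ (fun i hi j hj hij => horth hi hj hij _ _)
    (fun i hi j hj hij => ?_) fun i hi => ?_
  · simp only [hcomm]
    exact horth hi hj hij _ _
  · have hi := Finset.mem_range.1 hi
    rw [← hterm, map_smul, map_smul, Complex.coe_smul]
    exact (norm_apply_increment_sub_le hK (π.point_le_tag i hi) (π.tag_le_point i hi) z).trans
      (mul_le_mul_of_nonneg_right (hπ i hi).le (norm_nonneg _))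

theorem apply_stieltjesIntegral (hK : IsSelfAdjoint K) (hinj : Function.Injective K)
    (hab : a ≤ b) (z : Y) :
    K (stieltjesIntegral (fun ω : ℝ => (ω : ℂ)) (inverseSpectralProjection K) a b z) =
      increment (inverseSpectralProjection K) a b z := by
  set E := inverseSpectralProjection K
  have hE : IsProjectionFamily E := isProjectionFamily_inverseSpectralProjection K
  have := neBot_meshFilter hab
  have hlim : Tendsto (fun π => ‖K (increment E a b z) -
      K (K (stieltjesSum (fun ω : ℝ => (ω : ℂ)) E π z))‖) (meshFilter a b)
      (𝓝 ‖K (increment E a b z) -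
        K (K (stieltjesIntegral (fun ω : ℝ => (ω : ℂ)) E a b z))‖) :=
    (((K.comp (K.comp (ContinuousLinearMap.apply ℂ Y z))).continuous.tendsto _).comp
      (hE.tendsto_stieltjesSum Complex.continuous_ofReal hab)).const_sub _ |>.norm
  have hle (δ : ℝ) (hδ : 0 < δ) : ‖K (increment E a b z) -
      K (K (stieltjesIntegral (fun ω : ℝ => (ω : ℂ)) E a b z))‖ ≤
        δ * ‖K (K (increment E a b z))‖ := by
    refine le_of_tendsto hlim ?_
    filter_upwards [(hasBasis_meshFilter a b).mem_of_mem hδ] with π hπ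
    exact norm_apply_increment_sub_stieltjesSum_le hK hδ.le π hπ z
  have hzero : Tendsto (fun δ : ℝ => δ * ‖K (K (increment E a b z))‖) (𝓝[>] 0) (𝓝 0) :=
    tendsto_nhdsWithin_of_tendsto_nhds ((continuous_mul_const _).tendsto' _ _ (zero_mul _))
  have h := norm_le_zero_iff.1 (ge_of_tendsto hzero (eventually_mem_nhdsWithin.mono hle))
  exact (hinj (sub_eq_zero.1 h)).symm

theorem IsInverseOf.isSpectralResolution {H : Y →ₗ.[ℂ] Y} (h : IsInverseOf H K)
    (hK : IsSelfAdjoint K) : IsSpectralResolution H (inverseSpectralProjection K) := by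
  have hE := isResolutionOfIdentity_inverseSpectralProjection hK h.injective
  have hcomm (a b : ℝ) (y : Y) : K (increment (inverseSpectralProjection K) a b y) =
      increment (inverseSpectralProjection K) a b (K y) :=
    DFunLike.congr_fun ((commute_inverseSpectralProjection hK b).sub_right
      (commute_inverseSpectralProjection hK a)).eq y
  refine
    { projection := hE.isStarProjection
      mono := hE.mul_of_le
      right_continuous := tendsto_inverseSpectralProjection_nhdsGT hK
      tendsto_atBot := hE.tendsto_atBot
      tendsto_atTop := hE.tendsto_atTop
      integral := fun z y => ?_ }
  rw [h, hE.hasStieltjesIntegral_iff Complex.continuous_ofReal]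
  constructor
  · rintro rfl a b hab
    apply h.injective
    rw [apply_stieltjesIntegral hK h.injective hab, hcomm]
  · intro hy
    refine hE.ext_increment fun a b hab => ?_
    rw [← hcomm, hy a b hab, apply_stieltjesIntegral hK h.injective hab]

end InverseSpectralProjection

section Schrodinger

variable {Y : Type*} [NormedAddCommGroup Y] [InnerProductSpace ℂ Y] [CompleteSpace Y]
  {Λ : Y →ₗ.[ℂ] Y}

theorem mem_graph_schrodingerOp {J : Y →ₗ[ℂ] Y} {z w : Y} :
    (z, w) ∈ (schrodingerOp Λ J).graph ↔
      ∃ v, (z, v) ∈ Λ.graph ∧ (Complex.I • J v, w) ∈ Λ.graph := by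
  constructor
  · intro h
    obtain ⟨⟨z, hz⟩, rfl, rfl⟩ := (LinearPMap.mem_graph_iff _).1 h
    obtain ⟨hzΛ, hJz⟩ := mem_schrodingerDomain.1 hz
    exact ⟨Λ ⟨z, hzΛ⟩, Λ.mem_graph ⟨z, hzΛ⟩,
      Λ.mem_graph ⟨Complex.I • J (Λ ⟨z, hzΛ⟩), Λ.domain.smul_mem Complex.I hJz⟩⟩
  · rintro ⟨v, hzv, hvw⟩
    obtain ⟨z, rfl, rfl⟩ := (LinearPMap.mem_graph_iff _).1 hzv
    have hJz : J (Λ z) ∈ Λ.domain :=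
      (Λ.domain.smul_mem_iff Complex.I_ne_zero).1 (LinearPMap.mem_domain_of_mem_graph hvw)
    obtain ⟨v, hv, rfl⟩ := (LinearPMap.mem_graph_iff _).1 hvw
    refine (LinearPMap.mem_graph_iff _).2 ⟨⟨z, mem_schrodingerDomain.2 ⟨z.2, hJz⟩⟩, rfl, ?_⟩
    exact congrArg Λ (Subtype.ext hv.symm)

theorem isInverseOf_schrodingerOp {Q J J' : Y →L[ℂ] Y} (h : IsInverseOf Λ Q) (hJ : J * J' = 1)
    (hJ' : J' * J = 1) :
    IsInverseOf (schrodingerOp Λ (J : Y →ₗ[ℂ] Y)) (-Complex.I • (Q * J' * Q)) := by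
  have hJJ' (v : Y) : J (J' v) = v := DFunLike.congr_fun hJ v
  have hJ'J (v : Y) : J' (J v) = v := DFunLike.congr_fun hJ' v
  intro z w
  rw [mem_graph_schrodingerOp]
  change _ ↔ -Complex.I • Q (J' (Q w)) = z
  constructor
  · rintro ⟨v, hzv, hvw⟩
    rw [h] at hzv hvw
    rw [hvw, ContinuousLinearMap.coe_coe, map_smul, map_smul, hJ'J, smul_smul, hzv]
    simp
  · rintro rfl
    refine ⟨-Complex.I • J' (Q w), ?_, ?_⟩
    · rw [h, map_smul]
    · rw [h, ContinuousLinearMap.coe_coe, map_smul, hJJ', smul_smul]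
      simp

end Schrodinger

theorem IsInverseOf.exists_inverse_apply_eq {𝕜 E : Type*} [NormedField 𝕜] [NormedAddCommGroup E]
    [NormedSpace 𝕜 E] {T : E →ₗ.[𝕜] E} {A : E →L[𝕜] E} (h : IsInverseOf T A) {x : T.domain} {y : E}
    (hxy : y = T x) : ∃ hy : y ∈ T.inverse.domain, x = T.inverse ⟨y, hy⟩ := by
  have hy : y ∈ T.inverse.domain := by
    rw [LinearPMap.inverse_domain]
    exact ⟨x, hxy.symm⟩
  exact ⟨hy, (LinearPMap.inverse_apply_eq (y := ⟨y, hy⟩)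
    (LinearMap.ker_eq_bot.2 h.bijective.1) hxy.symm).symm⟩

theorem isPositive_mul_self {𝕜 E : Type*} [RCLike 𝕜] [NormedAddCommGroup E]
    [InnerProductSpace 𝕜 E] [CompleteSpace E] {Q : E →L[𝕜] E} (hQ : IsSelfAdjoint Q) :
    (Q * Q).IsPositive := by
  have h := ContinuousLinearMap.isPositive_adjoint_comp_self Q
  rwa [← ContinuousLinearMap.star_eq_adjoint, hQ.star_eq] at h

theorem isInverseOf_opSqrt {𝕜 E : Type*} [RCLike 𝕜] [NormedAddCommGroup E]
    [InnerProductSpace 𝕜 E] [CompleteSpace E] {T : E →ₗ.[𝕜] E} {Q : E →L[𝕜] E}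
    (h : IsInverseOf T (Q * Q)) (hQ : Q.IsPositive)
    (huniq : ∃! P : E →L[𝕜] E, P.IsPositive ∧ P * P = Q * Q) : IsInverseOf (opSqrt T) Q := by
  have hS : IsPosSqrt T (opSqrt T) :=
    Classical.epsilon_spec (existsUnique_isPosSqrt h huniq).exists
  obtain ⟨P, hP, hPQ, hSP⟩ := (isPosSqrt_iff h).1 hS
  rwa [huniq.unique ⟨hP, hPQ⟩ ⟨hQ, rfl⟩] at hSP

section Generator

variable {X : Type*} [NormedAddCommGroup X] [InnerProductSpace ℝ X] [CompleteSpace X]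
  {B : X →ₗ.[ℝ] X} {R : X →L[ℝ] X} {J : X ≃L[ℝ] X}

theorem star_mapCLM (T : X →L[ℝ] X) : star (mapCLM T) = mapCLM (star T) := by
  refine ((ContinuousLinearMap.eq_adjoint_iff _ _).2 fun z w => ?_).symm
  rw [inner_def, inner_def]
  simp [ContinuousLinearMap.star_eq_adjoint, ContinuousLinearMap.adjoint_inner_left]

/-- The inverse of `Λ J Λ`, where `R` is the inverse of `Λ`. -/
def hamiltonInverse (R : X →L[ℝ] X) (J : X ≃L[ℝ] X) : X →L[ℝ] X :=
  R * (J.symm : X →L[ℝ] X) * R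

theorem star_hamiltonInverse (hR : IsSelfAdjoint R)
    (hJ : ContinuousLinearMap.adjoint (J : X →L[ℝ] X) = -J) :
    star (hamiltonInverse R J) = -hamiltonInverse R J := by
  have hJsymm : star (J.symm : X →L[ℝ] X) = -J.symm := by
    have hinv : star (J.symm : X →L[ℝ] X) * star (J : X →L[ℝ] X) = 1 := by
      rw [← star_mul, ContinuousLinearMap.mul_def, J.coe_comp_coe_symm]
      exact star_one _
    rw [ContinuousLinearMap.star_eq_adjoint (J : X →L[ℝ] X), hJ] at hinv
    refine ContinuousLinearMap.ext fun x => ?_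
    simpa [map_neg, neg_eq_iff_eq_neg] using DFunLike.congr_fun hinv (J.symm x)
  rw [hamiltonInverse, star_mul, star_mul, hR.star_eq, hJsymm, neg_mul, mul_neg, mul_assoc]

/-- The inverse of `complexGenerator J B`, where `R` is the inverse of the square root of `B`. -/
def generatorInverse (R : X →L[ℝ] X) (J : X ≃L[ℝ] X) :
    Complexification X →L[ℂ] Complexification X :=
  -Complex.I • mapCLM (hamiltonInverse R J)

theorem isSelfAdjoint_generatorInverse (hR : IsSelfAdjoint R)
    (hJ : ContinuousLinearMap.adjoint (J : X →L[ℝ] X) = -J) :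
    IsSelfAdjoint (generatorInverse R J) := by
  rw [IsSelfAdjoint, generatorInverse, star_smul, star_mapCLM, star_hamiltonInverse hR hJ]
  refine ContinuousLinearMap.ext fun z => Complexification.ext ?_ ?_ <;> simp

theorem isInverseOf_complexGenerator (h : IsInverseOf B (R * R)) (hR : R.IsPositive)
    (J : X ≃L[ℝ] X) : IsInverseOf (complexGenerator J B) (generatorInverse R J) := by
  have hR' := isPositive_mapCLM_iff.2 hR
  have h' := mapCLM_mul R R ▸ h.mapLinearPMap
  have hsqrt : IsInverseOf (opSqrt (mapLinearPMap B)) (mapCLM R) :=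
    isInverseOf_opSqrt h' hR' (existsUnique_sqrt_complex (isPositive_mul_self hR'.isSelfAdjoint))
  have hJ : mapCLM (J : X →L[ℝ] X) * mapCLM (J.symm : X →L[ℝ] X) = 1 := by
    refine ContinuousLinearMap.ext fun z => Complexification.ext ?_ ?_ <;> simp
  have hJ' : mapCLM (J.symm : X →L[ℝ] X) * mapCLM (J : X →L[ℝ] X) = 1 := by
    refine ContinuousLinearMap.ext fun z => Complexification.ext ?_ ?_ <;> simp
  have hH := isInverseOf_schrodingerOp hsqrt hJ hJ'
  rw [← mapCLM_mul, ← mapCLM_mul] at hH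
  exact hH

theorem isEvolution_complexGenerator_iff
    (h : IsInverseOf (complexGenerator J B) (generatorInverse R J))
    {q : ℝ → Complexification X} : IsEvolution (complexGenerator J B) q ↔
      Continuous q ∧
        ∀ t : ℝ, mapCLM (hamiltonInverse R J) (q t - q 0) = ∫ s in (0 : ℝ)..t, q s := by
  have hI (t : ℝ) : generatorInverse R J (Complex.I • (q t - q 0)) =
      mapCLM (hamiltonInverse R J) (q t - q 0) := by
    rw [generatorInverse, smul_apply, map_smul, smul_smul]
    simp
  constructor
  · exact fun hq => ⟨hq.continuous, fun t => hI t ▸ (h _ _).1 (hq.integral_mem_graph t)⟩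
  · exact fun ⟨hq, hint⟩ => ⟨hq, fun t => (h _ _).2 ((hI t).trans (hint t))⟩

end Generator

theorem IsSpectralResolution.exists_hasStieltjesIntegral_cos_sin {Y : Type*}
    [NormedAddCommGroup Y] [InnerProductSpace ℂ Y] [CompleteSpace Y] {H : Y →ₗ.[ℂ] Y}
    {E : ℝ → Y →L[ℂ] Y} {q : ℝ → Y} (hE : IsSpectralResolution H E) (hq : IsEvolution H q) (t : ℝ) :
    ∃ C S : Y, HasStieltjesIntegral (fun ω => Real.cos (ω * t)) (fun ω => E ω (q 0)) C ∧
      HasStieltjesIntegral (fun ω => Real.sin (ω * t)) (fun ω => E ω (q 0)) S ∧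
      q t = C - Complex.I • S := by
  have hres := hE.isResolutionOfIdentity
  have hfam := hres.toIsProjectionFamily
  let c : ℝ → ℂ := fun ω => (Real.cos (ω * t) : ℂ)
  let s : ℝ → ℂ := fun ω => (Real.sin (ω * t) : ℂ)
  have hc : Continuous c := by fun_prop
  have hs : Continuous s := by fun_prop
  have hphase : phase t = c - Complex.I • s := by
    ext ω
    rw [phase, Complex.exp_mul_I, ← Complex.ofReal_cos, ← Complex.ofReal_sin, Real.cos_neg,
      Real.sin_neg, Complex.ofReal_neg, Pi.sub_apply, Pi.smul_apply, smul_eq_mul]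
    ring
  obtain ⟨C, hC⟩ := hres.exists_hasStieltjesIntegral hc zero_le_one
    (fun ω => (Complex.norm_real _).trans_le (Real.abs_cos_le_one _)) (q 0)
  obtain ⟨S, hS⟩ := hres.exists_hasStieltjesIntegral hs zero_le_one
    (fun ω => (Complex.norm_real _).trans_le (Real.abs_sin_le_one _)) (q 0)
  refine ⟨C, S, hC.of_ofReal, hS.of_ofReal, hres.ext_increment fun a b hab => ?_⟩
  rw [hE.increment_apply_evolution hq hab, hphase, hfam.stieltjesIntegral_sub hc
    (hs.const_smul _) hab,
    hfam.stieltjesIntegral_smul _ hs hab, map_sub, map_smul,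
    (hres.hasStieltjesIntegral_iff hc).1 hC a b hab,
    (hres.hasStieltjesIntegral_iff hs).1 hS a b hab]
  rfl

section RealEvolution

variable {X : Type*} [NormedAddCommGroup X] [InnerProductSpace ℝ X] [CompleteSpace X]
  {B : X →ₗ.[ℝ] X} {R : X →L[ℝ] X} {J : X ≃L[ℝ] X}
  {E : ℝ → Complexification X →L[ℂ] Complexification X}

theorem isEvolution_ofReal_iff (h : IsInverseOf (complexGenerator J B) (generatorInverse R J))
    {y : ℝ → X} : IsEvolution (complexGenerator J B) (fun t => ofReal (y t)) ↔
      Continuous y ∧ ∀ t : ℝ, hamiltonInverse R J (y t - y 0) = ∫ s in (0 : ℝ)..t, y s := by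
  have hcont : Continuous (fun t => ofReal (y t)) ↔ Continuous y :=
    ⟨fun hy => reCLM.continuous.comp hy, fun hy => ofRealCLM.continuous.comp hy⟩
  rw [isEvolution_complexGenerator_iff h, hcont]
  refine and_congr_right fun hy => forall_congr' fun t => ?_
  have hint : ∫ s in (0 : ℝ)..t, ofReal (y s) = ofReal (∫ s in (0 : ℝ)..t, y s) :=
    ofRealCLM.intervalIntegral_comp_comm (hy.intervalIntegrable 0 t)
  have hsub : ofReal (y t) - ofReal (y 0) = ofReal (y t - y 0) := (ofRealCLM.map_sub _ _).symm
  rw [hint, hsub, mapCLM_ofReal]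
  exact ⟨fun h => congrArg re h, fun h => congrArg ofReal h⟩

theorem IsEvolution.ofReal_re (h : IsInverseOf (complexGenerator J B) (generatorInverse R J))
    {q : ℝ → Complexification X} (hq : IsEvolution (complexGenerator J B) q) :
    IsEvolution (complexGenerator J B) (fun t => ofReal (re (q t))) := by
  refine (isEvolution_ofReal_iff h).2 ⟨reCLM.continuous.comp hq.continuous, fun t => ?_⟩
  have hint : re (∫ s in (0 : ℝ)..t, q s) = ∫ s in (0 : ℝ)..t, re (q s) :=
    (reCLM.intervalIntegral_comp_comm (hq.continuous.intervalIntegrable 0 t)).symm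
  rw [← hint, ← ((isEvolution_complexGenerator_iff h).1 hq).2 t, re_mapCLM, re_sub]

theorem IsSpectralResolution.exists_cos_add_sin
    (hE : IsSpectralResolution (complexGenerator J B) E) {y : ℝ → X}
    (hy : IsEvolution (complexGenerator J B) (fun t => ofReal (y t))) (t : ℝ) : ∃ I₁ I₂ : X,
      HasStieltjesIntegral (fun ω => Real.cos (ω * t)) (fun ω => realComponent E ω (y 0)) I₁ ∧
      HasStieltjesIntegral (fun ω => Real.sin (ω * t)) (fun ω => imagComponent E ω (y 0)) I₂ ∧
      I₁ + I₂ = y t := by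
  obtain ⟨C, S, hC, hS, hCS⟩ := hE.exists_hasStieltjesIntegral_cos_sin hy t
  refine ⟨re C, im S, hC.map reCLM, hS.map imCLM, ?_⟩
  simpa using (congrArg re hCS).symm

theorem isMildSolution_iff (hB : IsInverseOf B (R * R)) (hΛ : IsInverseOf (opSqrt B) R)
    (hH : IsInverseOf (complexGenerator J B) (generatorInverse R J))
    {u : C(ℝ, EnergySpace B)} : IsMildSolution J B u ↔
      IsEvolution (complexGenerator J B) (fun t => ofReal (EnergySpace.sqrtMap B (u t))) := by
  have hcont : Continuous fun t => EnergySpace.sqrtMap B (u t) :=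
    continuous_induced_dom.comp u.continuous
  have hincl (t : ℝ) : EnergySpace.incl B (u t) = R (EnergySpace.sqrtMap B (u t)) :=
    (hΛ.apply_apply (u t)).symm
  rw [isEvolution_ofReal_iff hH, and_iff_right hcont]
  refine forall_congr' fun t => ?_
  have hint : ∫ s in (0 : ℝ)..t, EnergySpace.incl B (u s) =
      R (∫ s in (0 : ℝ)..t, EnergySpace.sqrtMap B (u s)) := by
    simp only [hincl]
    exact R.intervalIntegral_comp_comm (hcont.intervalIntegrable 0 t)
  calc (∃ hx : (∫ s in (0 : ℝ)..t, EnergySpace.incl B (u s)) ∈ B.domain,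
        EnergySpace.incl B (u t) - EnergySpace.incl B (u 0) = J (B ⟨_, hx⟩))
      ↔ (∫ s in (0 : ℝ)..t, EnergySpace.incl B (u s),
          J.symm (EnergySpace.incl B (u t) - EnergySpace.incl B (u 0))) ∈ B.graph := by
        simp only [LinearPMap.mem_graph_iff', Subtype.exists, ← J.symm_apply_eq]
        simp [Prod.ext_iff, eq_comm]
    _ ↔ R (hamiltonInverse R J (EnergySpace.sqrtMap B (u t) - EnergySpace.sqrtMap B (u 0))) =
          R (∫ s in (0 : ℝ)..t, EnergySpace.sqrtMap B (u s)) := by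
        rw [hB, hint, hincl, hincl, ← map_sub R]
        rfl
    _ ↔ _ := hΛ.injective.eq_iff

theorem existsUnique_isMildSolution (hB : IsInverseOf B (R * R)) (hΛ : IsInverseOf (opSqrt B) R)
    (hH : IsInverseOf (complexGenerator J B) (generatorInverse R J))
    (hE : IsSpectralResolution (complexGenerator J B) E) (x₀ : EnergySpace B) :
    ∃! u : C(ℝ, EnergySpace B), u 0 = x₀ ∧ IsMildSolution J B u := by
  obtain ⟨q, hq, hq₀⟩ := hE.exists_evolution (ofReal (EnergySpace.sqrtMap B x₀))
  have hre := hq.ofReal_re hH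
  have hbij : Function.Bijective (EnergySpace.sqrtMap B) := hΛ.bijective
  choose u hu using fun t => hbij.2 (re (q t))
  have hcont : Continuous u := continuous_induced_rng.2
    ((reCLM.continuous.comp hq.continuous).congr fun t => (hu t).symm)
  refine ⟨⟨u, hcont⟩, ⟨hbij.1 ?_, (isMildSolution_iff hB hΛ hH).2 ?_⟩, ?_⟩
  · exact (hu 0).trans (by rw [hq₀, re_ofReal])
  · simpa only [ContinuousMap.coe_mk, hu] using hre
  · rintro v ⟨hv₀, hv⟩
    have hvq := hE.evolution_unique ((isMildSolution_iff hB hΛ hH).1 hv) hre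
      (by rw [hv₀, hq₀, re_ofReal])
    exact ContinuousMap.ext fun t => hbij.1
      ((congrArg re (congrFun hvq t)).trans (hu t).symm)

theorem energy_eq_of_isEvolution (hE : IsSpectralResolution (complexGenerator J B) E)
    {u : ℝ → EnergySpace B}
    (hu : IsEvolution (complexGenerator J B) (fun t => ofReal (EnergySpace.sqrtMap B (u t))))
    (t : ℝ) : EnergySpace.energy B (u t) = EnergySpace.energy B (u 0) := by
  have hnorm := hE.norm_evolution hu t
  rw [norm_ofReal, norm_ofReal] at hnorm
  rw [EnergySpace.energy, EnergySpace.energy, real_inner_self_eq_norm_sq,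
    real_inner_self_eq_norm_sq, hnorm]

end RealEvolution

end

end HamiltonSpectral

theorem corollary2p5_general {X : Type*} [NormedAddCommGroup X] [InnerProductSpace ℝ X]
    [CompleteSpace X] (B : X →ₗ.[ℝ] X) (hB : IsSelfAdjoint B) (hB_nonneg : IsNonneg B)
    (hB_inv : Function.Bijective B) (J : X ≃L[ℝ] X)
    (hJ : ContinuousLinearMap.adjoint (J : X →L[ℝ] X) = -J) :
    (∃! S, IsPosSqrt B S) ∧
    (∃! S, IsPosSqrt (Complexification.mapLinearPMap B) S) ∧
    Function.Bijective (opSqrt B) ∧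
    (∀ x₀ : EnergySpace B, ∃! u : C(ℝ, EnergySpace B), u 0 = x₀ ∧ IsMildSolution J B u) ∧
    (∀ u : C(ℝ, EnergySpace B), IsMildSolution J B u →
      ∀ t : ℝ, EnergySpace.energy B (u t) = EnergySpace.energy B (u 0)) ∧
    (∃ E, IsSpectralResolution (complexGenerator J B) E) ∧
    ∀ E, IsSpectralResolution (complexGenerator J B) E →
      ∀ u : C(ℝ, EnergySpace B), IsMildSolution J B u → ∀ t : ℝ, ∃ I₁ I₂ : X,
        HasStieltjesIntegral (fun ω : ℝ => Real.cos (ω * t))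
          (fun ω => realComponent E ω (EnergySpace.sqrtMap B (u 0))) I₁ ∧
        HasStieltjesIntegral (fun ω : ℝ => Real.sin (ω * t))
          (fun ω => imagComponent E ω (EnergySpace.sqrtMap B (u 0))) I₂ ∧
        ∃ h : I₁ + I₂ ∈ (opSqrt B).inverse.domain,
          EnergySpace.incl B (u t) = (opSqrt B).inverse ⟨I₁ + I₂, h⟩ := by
  obtain ⟨A, hA, hBA⟩ := exists_isPositive_isInverseOf hB hB_nonneg hB_inv
  obtain ⟨R, ⟨hR, rfl⟩, -⟩ := existsUnique_sqrt_real hA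
  have hΛ := isInverseOf_opSqrt hBA hR (existsUnique_sqrt_real hA)
  have hH := isInverseOf_complexGenerator hBA hR J
  have hF := hH.isSpectralResolution (isSelfAdjoint_generatorInverse hR.isSelfAdjoint hJ)
  refine ⟨existsUnique_isPosSqrt hBA (existsUnique_sqrt_real hA),
    existsUnique_isPosSqrt hBA.mapLinearPMap
      (existsUnique_sqrt_complex (Complexification.isPositive_mapCLM_iff.2 hA)),
    hΛ.bijective, existsUnique_isMildSolution hBA hΛ hH hF,
    fun u hu => energy_eq_of_isEvolution hF ((isMildSolution_iff hBA hΛ hH).1 hu),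
    ⟨_, hF⟩, fun E hE u hu t => ?_⟩
  obtain ⟨I₁, I₂, hcos, hsin, hsum⟩ :=
    hE.exists_cos_add_sin ((isMildSolution_iff hBA hΛ hH).1 hu) t
  exact ⟨I₁, I₂, hcos, hsin, hΛ.exists_inverse_apply_eq hsum⟩

theorem corollary2p5 {X : Type*} [NormedAddCommGroup X] [InnerProductSpace ℝ X] [CompleteSpace X]
    (B : X →ₗ.[ℝ] X) (hB : IsSelfAdjoint B) (hB_nonneg : IsNonneg B)
    (hB_inv : Function.Bijective B)
    (J : X →L[ℝ] X) (hJ : ContinuousLinearMap.adjoint J = -J) (hJ_sq : J.comp J = -1) :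
    -- the square roots of `B` and of its complexification are well defined,
    -- and `B^{1/2} : 𝒱 → X` is invertible
    (∃! S, IsPosSqrt B S) ∧
    (∃! S, IsPosSqrt (Complexification.mapLinearPMap B) S) ∧
    Function.Bijective (opSqrt B) ∧
    -- existence and uniqueness
    (∀ x₀ : EnergySpace B, ∃! u : C(ℝ, EnergySpace B), u 0 = x₀ ∧ IsMildSolution J B u) ∧
    -- energy conservation
    (∀ u : C(ℝ, EnergySpace B), IsMildSolution J B u →
      ∀ t : ℝ, EnergySpace.energy B (u t) = EnergySpace.energy B (u 0)) ∧
    -- spectral representation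
    (∃ E, IsSpectralResolution (complexGenerator J B) E) ∧
    ∀ E, IsSpectralResolution (complexGenerator J B) E →
      ∀ u : C(ℝ, EnergySpace B), IsMildSolution J B u → ∀ t : ℝ, ∃ I₁ I₂ : X,
        HasStieltjesIntegral (fun ω : ℝ => Real.cos (ω * t))
          (fun ω => realComponent E ω (EnergySpace.sqrtMap B (u 0))) I₁ ∧
        HasStieltjesIntegral (fun ω : ℝ => Real.sin (ω * t))
          (fun ω => imagComponent E ω (EnergySpace.sqrtMap B (u 0))) I₂ ∧
        ∃ h : I₁ + I₂ ∈ (opSqrt B).inverse.domain,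
          EnergySpace.incl B (u t) = (opSqrt B).inverse ⟨I₁ + I₂, h⟩ := by
  exact corollary2p5_general B hB hB_nonneg hB_inv
    (ContinuousLinearEquiv.equivOfInverse J (-J)
      (fun x => by simpa [neg_eq_iff_eq_neg] using DFunLike.congr_fun hJ_sq x)
      (fun x => by simpa [neg_eq_iff_eq_neg] using DFunLike.congr_fun hJ_sq x)) hJ
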